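/- Let $\alpha\in[1,2)$, $T>0$, $f_0\in L^2(0,1)$ and $u\in H^1(0,T)$ (all functions real-valued). Consider the boundary-controlled degenerate parabolic system $$\begin{cases}\partial_t f-\partial_x(x^\alpha\partial_x f)=0, & (t,x)\in(0,T)\times(0,1),\\ (x^\alpha\partial_x f)(t,x)|_{x=0}=0,\quad f(t,1)=u(t), & t\in(0,T),\\ f(0,x)=f_0(x), & x\in(0,1).\end{cases}$$ A weak solution is a function $f\in C^0([0,T];L^2(0,1))$ such that for every $t'\in[0,T]$ and every $\psi\in C^1([0,t'];L^2(0,1))\cap C^0([0,t'];H^2(0,1))$ with $(x^\alpha\partial_x\psi)(t,x)|_{x=0}=\psi(t,1)=0$ for all $t\in[0,t']$, $$\int_0^{t'}\!\int_0^1 f\,\bigl(\partial_t\psi+\partial_x(x^\alpha\partial_x\psi)\bigr)\,dx\,dt=\int_0^1 f(t',x)\psi(t',x)\,dx-\int_0^1 f_0(x)\psi(0,x)\,dx+\int_0^{t'}u(t)\,\partial_x\psi(t,1)\,dt.$$ Then the system has exactly one weak solution. -/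

import Mathlib

open MeasureTheory Set Filter Topology
open scoped ContDiff

noncomputable section

namespace DegenerateParabolic

/-- `g` is the weak (distributional) derivative of `f` on the interval `(a, b)`. -/
def HasWeakDeriv (a b : ℝ) (f g : ℝ → ℝ) : Prop :=
  LocallyIntegrableOn f (Ioo a b) ∧ LocallyIntegrableOn g (Ioo a b) ∧
    ∀ φ : ℝ → ℝ, ContDiff ℝ ∞ φ → HasCompactSupport φ → tsupport φ ⊆ Ioo a b →
      ∫ x in Ioo a b, f x * deriv φ x = -∫ x in Ioo a b, g x * φ x

open Classical in
/-- The weak derivative of `f` on `(a, b)`; it is determined up to a null set, and a version is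
chosen (it is `0` if `f` has no weak derivative). -/
def weakDeriv (a b : ℝ) (f : ℝ → ℝ) : ℝ → ℝ :=
  if h : ∃ g, HasWeakDeriv a b f g then h.choose else 0

/-- `f` belongs to the Sobolev space `H¹(a, b)`. -/
def MemH1 (a b : ℝ) (f : ℝ → ℝ) : Prop :=
  MemLp f 2 (volume.restrict (Ioo a b)) ∧
    ∃ g : ℝ → ℝ, MemLp g 2 (volume.restrict (Ioo a b)) ∧ HasWeakDeriv a b f g

/-- The real Hilbert space `L²(0, 1)`. -/
abbrev L2 : Type := Lp ℝ 2 (volume.restrict (Ioo (0 : ℝ) 1))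

lemma L2.locallyIntegrableOn (f : L2) : LocallyIntegrableOn (f : ℝ → ℝ) (Ioo (0 : ℝ) 1) := by
  have h : IntegrableOn (f : ℝ → ℝ) (Ioo (0 : ℝ) 1) volume :=
    (Lp.memLp f).integrable (by norm_num)
  exact h.locallyIntegrableOn

lemma L2.integrable_mul (f : L2) {φ : ℝ → ℝ} (hφ : Continuous φ) (hc : HasCompactSupport φ) :
    Integrable (fun x => f x * φ x) (volume.restrict (Ioo (0 : ℝ) 1)) := by
  have h : MemLp φ 2 (volume.restrict (Ioo (0 : ℝ) 1)) := hφ.memLp_of_hasCompactSupport hc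
  exact (Lp.memLp f).integrable_mul h

lemma HasWeakDeriv.add_L2 {f g f' g' : L2} (h : HasWeakDeriv 0 1 f g)
    (h' : HasWeakDeriv 0 1 f' g') : HasWeakDeriv 0 1 (f + f' : L2) (g + g' : L2) := by
  refine ⟨L2.locallyIntegrableOn _, L2.locallyIntegrableOn _, fun φ hφ hc hs => ?_⟩
  have hd : Continuous (deriv φ) := hφ.continuous_deriv (by simp)
  have e₁ : ∫ x in Ioo (0 : ℝ) 1, (f + f' : L2) x * deriv φ x
      = ∫ x in Ioo (0 : ℝ) 1, (f x * deriv φ x + f' x * deriv φ x) := by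
    refine integral_congr_ae ?_
    filter_upwards [Lp.coeFn_add f f'] with x hx
    rw [hx, Pi.add_apply, add_mul]
  have e₂ : ∫ x in Ioo (0 : ℝ) 1, (g + g' : L2) x * φ x
      = ∫ x in Ioo (0 : ℝ) 1, (g x * φ x + g' x * φ x) := by
    refine integral_congr_ae ?_
    filter_upwards [Lp.coeFn_add g g'] with x hx
    rw [hx, Pi.add_apply, add_mul]
  rw [e₁, e₂, integral_add (L2.integrable_mul f hd hc.deriv) (L2.integrable_mul f' hd hc.deriv),
    integral_add (L2.integrable_mul g hφ.continuous hc) (L2.integrable_mul g' hφ.continuous hc),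
    h.2.2 φ hφ hc hs, h'.2.2 φ hφ hc hs]
  ring

lemma HasWeakDeriv.smul_L2 (c : ℝ) {f g : L2} (h : HasWeakDeriv 0 1 f g) :
    HasWeakDeriv 0 1 (c • f : L2) (c • g : L2) := by
  refine ⟨L2.locallyIntegrableOn _, L2.locallyIntegrableOn _, fun φ hφ hc hs => ?_⟩
  have e₁ : ∫ x in Ioo (0 : ℝ) 1, (c • f : L2) x * deriv φ x
      = ∫ x in Ioo (0 : ℝ) 1, c * (f x * deriv φ x) := by
    refine integral_congr_ae ?_
    filter_upwards [Lp.coeFn_smul c f] with x hx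
    rw [hx, Pi.smul_apply, smul_eq_mul, mul_assoc]
  have e₂ : ∫ x in Ioo (0 : ℝ) 1, (c • g : L2) x * φ x
      = ∫ x in Ioo (0 : ℝ) 1, c * (g x * φ x) := by
    refine integral_congr_ae ?_
    filter_upwards [Lp.coeFn_smul c g] with x hx
    rw [hx, Pi.smul_apply, smul_eq_mul, mul_assoc]
  rw [e₁, e₂, integral_const_mul, integral_const_mul, h.2.2 φ hφ hc hs]
  ring

lemma HasWeakDeriv.zero_L2 : HasWeakDeriv 0 1 (0 : L2) (0 : L2) := by
  refine ⟨L2.locallyIntegrableOn _, L2.locallyIntegrableOn _, fun φ _ _ _ => ?_⟩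
  have e (k : ℝ → ℝ) : ∫ x in Ioo (0 : ℝ) 1, (0 : L2) x * k x = 0 := by
    refine integral_eq_zero_of_ae ?_
    filter_upwards [Lp.coeFn_zero ℝ 2 (volume.restrict (Ioo (0 : ℝ) 1))] with x hx
    rw [hx]
    simp
  rw [e, e, neg_zero]

/-- The Sobolev space `H²(0, 1)`. A function `f` is represented by the triple `(f, f', f'')` of
its weak derivatives (the last two entries are determined by the first), so that the topology
induced by `L² × L² × L²` is that of the `H²` norm. -/
def H2 : Submodule ℝ (L2 × L2 × L2) where
  carrier := {p | HasWeakDeriv 0 1 p.1 p.2.1 ∧ HasWeakDeriv 0 1 p.2.1 p.2.2}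
  add_mem' h h' := ⟨h.1.add_L2 h'.1, h.2.add_L2 h'.2⟩
  zero_mem' := ⟨HasWeakDeriv.zero_L2, HasWeakDeriv.zero_L2⟩
  smul_mem' c _ h := ⟨h.1.smul_L2 c, h.2.smul_L2 c⟩

/-- The function underlying an element of `H²(0, 1)`. -/
def toL2 (p : H2) : L2 := p.1.1

/-- The first derivative of an element of `H²(0, 1)`. -/
def dx (p : H2) : L2 := p.1.2.1

open Classical in
/-- The continuous representative on `[0, 1]` of a function on `(0, 1)` given up to null sets
(junk value `0` if there is none; elements of `H¹(0, 1)` always have one). -/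
def contRep (f : ℝ → ℝ) : ℝ → ℝ :=
  if h : ∃ g : ℝ → ℝ, ContinuousOn g (Icc 0 1) ∧ f =ᵐ[volume.restrict (Ioo (0 : ℝ) 1)] g
  then h.choose else 0

/-- `ψ ∈ C¹([0,τ]; L²(0,1)) ∩ C⁰([0,τ]; H²(0,1))` with the boundary conditions
`(x^α ∂ₓψ)(t,x)|_{x=0} = ψ(t,1) = 0` for all `t ∈ [0,τ]`. -/
structure IsTestFunction (α τ : ℝ) (ψ : ℝ → H2) : Prop where
  contDiffOn : ContDiffOn ℝ 1 (fun t => toL2 (ψ t)) (Icc 0 τ)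
  continuousOn : ContinuousOn ψ (Icc 0 τ)
  flux_zero : ∀ t ∈ Icc 0 τ,
    Tendsto (fun x : ℝ => x ^ α * contRep (dx (ψ t)) x) (𝓝[>] 0) (𝓝 0)
  eq_zero : ∀ t ∈ Icc 0 τ, contRep (toL2 (ψ t)) 1 = 0

/-- `f` is a weak solution on `[0,T]` of `∂ₜf - ∂ₓ(x^α ∂ₓf) = 0` with `(x^α ∂ₓf)(t,0) = 0`,
`f(t,1) = u(t)` and `f(0,·) = f₀`. Only the values of `f` on `[0,T]` matter. -/
structure IsWeakSolution (α T : ℝ) (f₀ : L2) (u : ℝ → ℝ) (f : ℝ → L2) : Prop where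
  continuousOn : ContinuousOn f (Icc 0 T)
  integral_identity : ∀ τ ∈ Icc 0 T, ∀ ψ : ℝ → H2, IsTestFunction α τ ψ →
    ∫ t in (0 : ℝ)..τ, ∫ x in Ioo (0 : ℝ) 1,
        f t x * (derivWithin (fun s => toL2 (ψ s)) (Icc 0 τ) t x
          + weakDeriv 0 1 (fun y => y ^ α * dx (ψ t) y) x)
      = (∫ x in Ioo (0 : ℝ) 1, f τ x * toL2 (ψ τ) x)
        - (∫ x in Ioo (0 : ℝ) 1, f₀ x * toL2 (ψ 0) x)
        + ∫ t in (0 : ℝ)..τ, u t * contRep (dx (ψ t)) 1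

end DegenerateParabolic

end

/-! Let D = ∂ₓ(x^α ∂ₓ). On H² functions vanishing at 1, the operator -D is inverted by the bounded
operator K = G*G (`green`), where G is the weighted Hardy operator v ↦ x^{-α/2} ∫₀ˣ v. It is bounded
because α < 2, so K is symmetric, nonnegative and definite. The flux x^α p' of an H² function p is
exactly ∫₀ˣ Dp. Hence the flux condition at 0 is automatic, and p'(1) = ⟨1, Dp⟩, so the boundary
control acts as a source u·1. Formally the system becomes K f' = -(f - u·1), or in integrated
("mild") form K f(t) = K f₀ - ∫₀ᵗ (f - u·1), with no unbounded operator left.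

Uniqueness: time-independent test functions already show that a difference h of weak solutions
satisfies K h(t) = -w(t) with w(t) = ∫₀ᵗ h. Then ⟨Kw, w⟩ has derivative -2‖w‖², so it stays 0, and
definiteness gives w = 0 and h = 0 (`IsWeakSolution.eqOn`, `eq_zero_of_apply_eq_neg_integral`).

Existence: with u = 0, the contractions exp(-t(K + ε)⁻¹) converge as ε → 0
(`exists_homogeneous_solution`). For u in H¹, Duhamel superposition of unit-step responses against
u' gives a mild solution (`exists_forced_solution`). A mild solution is weak: a test function is ψ =
K g with g = -Dψ, and ⟨f, K g⟩ obeys a product rule although f itself need not be differentiable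
(`hasDerivAt_inner_of_apply`). -/

open MeasureTheory Set Filter Topology
open scoped ContDiff

noncomputable section

namespace DegenerateParabolic

/-! ### Homogeneous abstract problem K y' = -y by regularised exponentials -/

section Abstract

open NormedSpace

variable {H : Type*} [NormedAddCommGroup H] [InnerProductSpace ℝ H]

section Inverse

variable {K B : H →L[ℝ] H} {ε : ℝ}

lemma commute_of_inverse (h1 : B * (K + ε • 1) = 1) (h2 : (K + ε • 1) * B = 1) {C : H →L[ℝ] H}
    (hC : Commute C K) : Commute C B := by
  have h : Commute C (K + ε • 1) := hC.add_right ((Commute.one_right C).smul_right ε)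
  have : C * B = B * C := by
    calc C * B = B * (K + ε • 1) * (C * B) := by rw [h1, one_mul]
      _ = B * ((K + ε • 1) * C) * B := by noncomm_ring
      _ = B * (C * (K + ε • 1)) * B := by rw [h.eq]
      _ = B * C * ((K + ε • 1) * B) := by noncomm_ring
      _ = B * C := by rw [h2, mul_one]
  exact this

lemma inner_inverse_nonneg (hp : ∀ x, 0 ≤ inner ℝ (K x) x) (hε : 0 < ε)
    (h2 : (K + ε • 1) * B = 1) (x : H) : 0 ≤ inner ℝ (B x) x := by
  have hx : K (B x) + ε • B x = x := by simpa using DFunLike.congr_fun h2 x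
  have : inner ℝ (B x) x = inner ℝ (K (B x)) (B x) + ε * inner ℝ (B x) (B x) := by
    conv_lhs => rw [← hx]
    rw [hx]
    conv_lhs => rw [← hx]
    rw [inner_add_right, inner_smul_right, hx, real_inner_comm]
  rw [this]
  have := hp (B x)
  have := real_inner_self_nonneg (x := B x)
  positivity

/-- With y = B K z one has K(z - y) = εy, so positivity of K gives ⟨y, z - y⟩ ≥ 0. The bound is
uniform in ε, whereas B alone may blow up as ε → 0. -/
lemma norm_inverse_apply_le (hp : ∀ x, 0 ≤ inner ℝ (K x) x) (hε : 0 < ε)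
    (h2 : (K + ε • 1) * B = 1) (z : H) : ‖B (K z)‖ ≤ ‖z‖ := by
  have hx : K (B (K z)) + ε • B (K z) = K z := by simpa using DFunLike.congr_fun h2 (K z)
  set y := B (K z)
  have h3 : K (z - y) = ε • y := by rw [map_sub, ← hx]; abel
  have h4 := hp (z - y)
  rw [h3, inner_smul_left] at h4
  have h5 : 0 ≤ inner ℝ y (z - y) := by
    simpa using nonneg_of_mul_nonneg_right h4 (by simpa using hε)
  rw [inner_sub_right, real_inner_self_eq_norm_sq] at h5
  have h6 := real_inner_le_norm y z
  by_contra! hlt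
  nlinarith [norm_nonneg z]

end Inverse

variable [CompleteSpace H]

lemma hasDerivAt_exp_smul_apply (A : H →L[ℝ] H) (s : ℝ) (x : H) :
    HasDerivAt (fun r : ℝ => exp (r • A) x) (A (exp (s • A) x)) s := by
  simpa using (hasDerivAt_exp_smul_const' (𝕂 := ℝ) A s).clm_apply (hasDerivAt_const s x)

/-- The exponential `e^{-tB}` of a bounded accretive operator is a contraction for `t ≥ 0`. -/
lemma norm_exp_neg_smul_apply_le {B : H →L[ℝ] H} (hB : ∀ x, 0 ≤ inner ℝ (B x) x) {t : ℝ}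
    (ht : 0 ≤ t) (x : H) : ‖exp (t • (-B)) x‖ ≤ ‖x‖ := by
  have hd (s : ℝ) : HasDerivAt (fun r : ℝ => exp (r • (-B)) x) ((-B) (exp (s • (-B)) x)) s :=
    hasDerivAt_exp_smul_apply (-B) s x
  have hd2 (s : ℝ) := (hd s).norm_sq
  have hanti : Antitone (fun s : ℝ => ‖exp (s • (-B)) x‖ ^ 2) := by
    refine antitone_of_deriv_nonpos (fun s => (hd2 s).differentiableAt) fun s => ?_
    rw [(hd2 s).deriv, neg_apply, inner_neg_right, real_inner_comm]
    linarith [hB (exp (s • (-B)) x)]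
  have h := hanti ht
  simp only [zero_smul, exp_zero, one_apply_eq_self] at h
  exact (sq_le_sq₀ (norm_nonneg _) (norm_nonneg _)).1 h

/-- Comparison of the exponentials of two commuting bounded accretive operators. -/
lemma norm_exp_sub_exp_apply_le {A B : H →L[ℝ] H} (hA : ∀ x, 0 ≤ inner ℝ (A x) x)
    (hB : ∀ x, 0 ≤ inner ℝ (B x) x) (hAB : Commute A B) {t : ℝ} (ht : 0 ≤ t) (x : H) :
    ‖exp (t • (-A)) x - exp (t • (-B)) x‖ ≤ ‖(A - B) x‖ * t := by
  -- This path joins exp(-tB)x to exp(-tA)x. By commutation its derivative is two contractions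
  -- applied to (B - A)x.
  set φ : ℝ → H := fun s => exp ((t - s) • (-B)) (exp (s • (-A)) x) with hφ
  have hd (s : ℝ) : HasDerivAt φ (exp ((t - s) • (-B)) (exp (s • (-A)) ((B - A) x))) s := by
    have h1 := hasDerivAt_exp_smul_const' (𝕂 := ℝ) (-B) (t - s)
    have h2 : HasDerivAt (fun r : ℝ => t - r) (-1) s := by
      simpa using (hasDerivAt_id s).const_sub t
    have h3 := h1.scomp s h2
    have h4 : HasDerivAt (fun r : ℝ => exp (r • (-A)) x) ((-A) (exp (s • (-A)) x)) s :=
      hasDerivAt_exp_smul_apply (-A) s x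
    refine (h3.clm_apply h4).congr_deriv ?_
    have c1 : Commute B (exp (s • (-A))) :=
      ((hAB.symm.neg_right).smul_right s).exp_right
    have c2 : Commute B (exp ((t - s) • (-B))) :=
      (((Commute.refl B).neg_right).smul_right (t - s)).exp_right
    have e1 : ∀ z, B (exp (s • (-A)) z) = exp (s • (-A)) (B z) := fun z =>
      DFunLike.congr_fun c1.eq z
    have e2 : ∀ z, B (exp ((t - s) • (-B)) z) = exp ((t - s) • (-B)) (B z) := fun z =>
      DFunLike.congr_fun c2.eq z
    have e3 : ∀ z, A (exp (s • (-A)) z) = exp (s • (-A)) (A z) := fun z =>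
      DFunLike.congr_fun (((Commute.refl A).neg_right).smul_right s).exp_right.eq z
    have e4 : ((-1 : ℝ) • (-B * exp ((t - s) • (-B)))) (exp (s • (-A)) x)
        = B (exp ((t - s) • (-B)) (exp (s • (-A)) x)) := by simp
    rw [e4, e2, e1, neg_apply, e3, sub_apply, map_neg, map_sub, map_sub]
    exact (sub_eq_add_neg _ _).symm
  have := norm_image_sub_le_of_norm_deriv_le_segment' (f := φ) (a := 0) (b := t)
    (C := ‖(A - B) x‖) (fun s _ => (hd s).hasDerivWithinAt) (fun s hs => by
      refine (norm_exp_neg_smul_apply_le hB (by linarith [hs.2]) _).trans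
        ((norm_exp_neg_smul_apply_le hA hs.1 _).trans ?_)
      rw [← neg_sub A B, neg_apply, norm_neg]) t ⟨ht, le_rfl⟩
  simpa [hφ] using this

variable {K : H →L[ℝ] H}

lemma exists_inverse_add_smul (hp : ∀ x, 0 ≤ inner ℝ (K x) x) {ε : ℝ} (hε : 0 < ε) :
    ∃ B : H →L[ℝ] H, B * (K + ε • 1) = 1 ∧ (K + ε • 1) * B = 1 := by
  have : IsUnit (K + ε • (1 : H →L[ℝ] H)) := by
    refine ContinuousLinearMap.isUnit_of_forall_le_norm_inner_map _ (c := ⟨ε, hε.le⟩) hε fun x => ?_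
    have h1 : inner ℝ ((K + ε • (1 : H →L[ℝ] H)) x) x = inner ℝ (K x) x + ε * ‖x‖ ^ 2 := by
      simp [inner_add_left, inner_smul_left]
    rw [h1]
    refine le_trans ?_ (le_abs_self _)
    have := hp x
    change ‖x‖ ^ 2 * ε ≤ _
    linarith
  obtain ⟨U, hU⟩ := this
  exact ⟨↑U⁻¹, by rw [← hU]; simp, by rw [← hU]; simp⟩

/-- If x is orthogonal to the range of K², pairing it with K⁴x gives ‖K²x‖² = 0. Vectors K²z are
those on which the regularised exponentials converge at an explicit rate. -/
lemma dense_range_comp_self (hs : ∀ x y, inner ℝ (K x) y = inner ℝ x (K y))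
    (hi : Function.Injective K) : DenseRange fun z => K (K z) := by
  have h : ((K * K : H →L[ℝ] H) : H →ₗ[ℝ] H).range.topologicalClosure = ⊤ := by
    rw [Submodule.topologicalClosure_eq_top_iff, Submodule.eq_bot_iff]
    intro x hx
    rw [Submodule.mem_orthogonal] at hx
    have h0 := hx (K (K (K (K x)))) ⟨K (K x), rfl⟩
    have h1 : K (K x) = 0 := by
      rw [hs, hs] at h0
      exact inner_self_eq_zero.1 h0
    exact hi (hi (by simpa using h1))
  have := Submodule.dense_iff_topologicalClosure_eq_top.2 h
  rw [LinearMap.coe_range] at this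
  exact this

/-- Mild solutions of the homogeneous problem `K y' = -y`, `y 0 = x`. -/
lemma exists_homogeneous_solution (hs : ∀ x y, inner ℝ (K x) y = inner ℝ x (K y))
    (hp : ∀ x, 0 ≤ inner ℝ (K x) x) (hi : Function.Injective K) {T : ℝ} (hT : 0 ≤ T) (x : H) :
    ∃ Y : ℝ → H, Continuous Y ∧ (∀ t, ‖Y t‖ ≤ ‖x‖) ∧ (∀ t ≤ 0, Y t = x) ∧
      ∀ t ∈ Icc 0 T, K (Y t) = K x - ∫ s in (0 : ℝ)..t, Y s := by
  set ε : ℕ → ℝ := fun n => 1 / ((n : ℝ) + 1) with hεdef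
  have hε (n : ℕ) : 0 < ε n := by positivity
  have hεlim : Tendsto ε atTop (𝓝 0) := tendsto_one_div_add_atTop_nhds_zero_nat
  choose B hB1 hB2 using fun n => exists_inverse_add_smul hp (hε n)
  have hBp (n : ℕ) (x : H) : 0 ≤ inner ℝ (B n x) x := inner_inverse_nonneg hp (hε n) (hB2 n) x
  have hKB (n : ℕ) : Commute K (B n) := commute_of_inverse (hB1 n) (hB2 n) (Commute.refl K)
  have hBB (n m : ℕ) : Commute (B n) (B m) :=
    commute_of_inverse (hB1 m) (hB2 m) (hKB n).symm
  -- Resolvent identity: the difference is (ε m - ε n) B n B m, and each factor K absorbs one B.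
  have hsub (n m : ℕ) (z : H) : ‖(B n - B m) (K (K z))‖ ≤ |ε n - ε m| * ‖z‖ := by
    have e1 : B n - B m = (ε m - ε n) • (B n * B m) := by
      calc B n - B m = B n * ((K + ε m • 1) * B m) - (B n * (K + ε n • 1)) * B m := by
            rw [hB1, hB2, mul_one, one_mul]
        _ = (ε m - ε n) • (B n * B m) := by
            simp only [mul_add, add_mul, smul_mul_assoc, one_mul, mul_smul_comm, mul_one,
              mul_assoc, sub_smul]
            abel
    have e2 : (B n * B m) (K (K z)) = B n (K (B m (K z))) := by
      have : B m (K (K z)) = K (B m (K z)) := DFunLike.congr_fun (hKB m).symm.eq (K z)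
      simp [this]
    rw [e1, smul_apply, e2, norm_smul, Real.norm_eq_abs, abs_sub_comm]
    gcongr
    exact (norm_inverse_apply_le hp (hε n) (hB2 n) _).trans
      (norm_inverse_apply_le hp (hε m) (hB2 m) _)
  set y : ℕ → ℝ → H := fun n t => exp (t • (-(B n))) x with hy
  have hyd (n : ℕ) (s : ℝ) : HasDerivAt (y n) (-(B n (y n s))) s :=
    hasDerivAt_exp_smul_apply (-(B n)) s x
  have hyc (n : ℕ) : Continuous (y n) :=
    continuous_iff_continuousAt.2 fun s => (hyd n s).continuousAt
  have hyle (n : ℕ) {t : ℝ} (ht : 0 ≤ t) : ‖y n t‖ ≤ ‖x‖ :=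
    norm_exp_neg_smul_apply_le (hBp n) ht x
  -- Replace x by a nearby K²z: contractivity controls the error uniformly in n and t, and `hsub`
  -- handles K²z.
  have hcauchy : UniformCauchySeqOn y atTop (Icc 0 T) := by
    rw [Metric.uniformCauchySeqOn_iff]
    intro η hη
    obtain ⟨z, hz⟩ := (dense_range_comp_self hs hi).exists_dist_lt x (ε := η / 4) (by positivity)
    have hpos : 0 < η / (4 * (‖z‖ + 1) * (T + 1)) := by positivity
    obtain ⟨N, hN⟩ := (Metric.cauchySeq_iff.1 hεlim.cauchySeq) _ hpos
    refine ⟨N, fun m hm n hn t ht => ?_⟩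
    have h1 : ‖exp (t • (-(B m))) (K (K z)) - exp (t • (-(B n))) (K (K z))‖ ≤ η / 4 := by
      refine (norm_exp_sub_exp_apply_le (hBp m) (hBp n) (hBB m n) ht.1 _).trans ?_
      have h2 := hN m hm n hn
      rw [Real.dist_eq] at h2
      calc _ ≤ |ε m - ε n| * ‖z‖ * t := by gcongr; exacts [ht.1, hsub m n z]
        _ ≤ η / (4 * (‖z‖ + 1) * (T + 1)) * (‖z‖ + 1) * (T + 1) := by
            have := ht.2
            have := ht.1
            gcongr <;> linarith
        _ = η / 4 := by field_simp
    have h2 (k : ℕ) : ‖exp (t • (-(B k))) (x - K (K z))‖ < η / 4 := by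
      refine (norm_exp_neg_smul_apply_le (hBp k) ht.1 _).trans_lt ?_
      rwa [← dist_eq_norm]
    have e : y m t - y n t = exp (t • (-(B m))) (x - K (K z))
        - exp (t • (-(B n))) (x - K (K z))
        + (exp (t • (-(B m))) (K (K z)) - exp (t • (-(B n))) (K (K z))) := by
      simp only [map_sub, hy]; abel
    rw [dist_eq_norm, e]
    have := norm_add_le (exp (t • (-(B m))) (x - K (K z)) - exp (t • (-(B n))) (x - K (K z)))
      (exp (t • (-(B m))) (K (K z)) - exp (t • (-(B n))) (K (K z)))
    have := norm_sub_le (exp (t • (-(B m))) (x - K (K z))) (exp (t • (-(B n))) (x - K (K z)))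
    linarith [h2 m, h2 n]
  have hlim (t : ℝ) (ht : t ∈ Icc 0 T) : ∃ l, Tendsto (fun n => y n t) atTop (𝓝 l) :=
    cauchySeq_tendsto_of_complete (hcauchy.cauchySeq ht)
  choose! Y hY using hlim
  have hunif : TendstoUniformlyOn y Y atTop (Icc 0 T) :=
    hcauchy.tendstoUniformlyOn_of_tendsto hY
  have hYc : ContinuousOn Y (Icc 0 T) :=
    hunif.continuousOn (Frequently.of_forall fun n => (hyc n).continuousOn)
  have hY0 : Y 0 = x := by
    refine tendsto_nhds_unique (hY 0 ⟨le_rfl, hT⟩) ?_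
    simp [hy]
  -- The constant extension takes the value x for t ≤ 0, which later makes the step response vanish
  -- before time 0.
  refine ⟨IccExtend hT ((Icc 0 T).domRestrict Y), ?_, fun t => ?_, fun t ht => ?_, fun t ht => ?_⟩
  · exact (continuousOn_iff_continuous_domRestrict.1 hYc).Icc_extend'
  · have hm := (projIcc 0 T hT t).2
    exact le_of_tendsto (hY _ hm).norm (Eventually.of_forall fun n => hyle n hm.1)
  · rw [IccExtend_of_le_left _ _ ht]
    exact hY0
  have eint : ∫ s in (0 : ℝ)..t, IccExtend hT ((Icc 0 T).domRestrict Y) s = ∫ s in (0 : ℝ)..t, Y s := by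
    refine intervalIntegral.integral_congr fun s hs' => ?_
    rw [uIcc_of_le ht.1] at hs'
    exact IccExtend_of_mem hT _ (⟨hs'.1, hs'.2.trans ht.2⟩ : s ∈ Icc 0 T)
  rw [eint, IccExtend_of_mem hT _ ht]
  change K (Y t) = _
  -- Integrated form of (K + ε n) y' = -y; the ε n terms disappear in the limit.
  have hn (n : ℕ) : K (y n t) + ε n • y n t = K x + ε n • x - ∫ s in (0 : ℝ)..t, y n s := by
    have hd (s : ℝ) : HasDerivAt (fun r => (K + ε n • (1 : H →L[ℝ] H)) (y n r)) (-(y n s)) s := by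
      refine ((K + ε n • (1 : H →L[ℝ] H)).hasFDerivAt.comp_hasDerivAt s (hyd n s)).congr_deriv ?_
      have := DFunLike.congr_fun (hB2 n) (y n s)
      rw [map_neg]
      exact congrArg Neg.neg this
    have := intervalIntegral.integral_eq_sub_of_hasDerivAt (fun s _ => hd s)
      ((hyc n).neg.intervalIntegrable 0 t)
    rw [intervalIntegral.integral_neg] at this
    have h0 : y n 0 = x := by simp [hy]
    simp only [h0, add_apply, smul_apply,
      one_apply_eq_self] at this
    rw [sub_eq_add_neg, this]
    abel
  have l1 : Tendsto (fun n => K (y n t) + ε n • y n t) atTop (𝓝 (K (Y t) + (0 : ℝ) • Y t)) :=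
    ((K.continuous.tendsto _).comp (hY t ht)).add (hεlim.smul (hY t ht))
  have l2 : Tendsto (fun n => ∫ s in (0 : ℝ)..t, y n s) atTop (𝓝 (∫ s in (0 : ℝ)..t, Y s)) := by
    refine intervalIntegral.tendsto_integral_filter_of_dominated_convergence (fun _ => ‖x‖)
      (Eventually.of_forall fun n => (hyc n).aestronglyMeasurable)
      (Eventually.of_forall fun n => ae_of_all _ fun s hs' => ?_)
      intervalIntegrable_const (ae_of_all _ fun s hs' => ?_)
    · rw [uIoc_of_le ht.1] at hs'
      exact hyle n hs'.1.le
    · rw [uIoc_of_le ht.1] at hs'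
      exact hY s ⟨hs'.1.le, hs'.2.trans ht.2⟩
  have l3 : Tendsto (fun n => K x + ε n • x - ∫ s in (0 : ℝ)..t, y n s) atTop
      (𝓝 (K x + (0 : ℝ) • x - ∫ s in (0 : ℝ)..t, Y s)) :=
    ((hεlim.smul_const x).const_add _).sub l2
  simp only [hn] at l1
  simpa using tendsto_nhds_unique l1 l3

end Abstract

/-! ### Mild solutions: product rule, uniqueness, and forcing -/

section Mild

variable {H : Type*} [NormedAddCommGroup H] [InnerProductSpace ℝ H]

/-- Product rule for `⟪f, K g⟫` when only `K f` and `K g` are known to be differentiable. -/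
lemma hasDerivAt_inner_of_apply {K : H →L[ℝ] H} (hs : ∀ x y, inner ℝ (K x) y = inner ℝ x (K y))
    {f w ψ g : ℝ → H} {k w' ψ' : H} {t : ℝ} (hf : ∀ᶠ s in 𝓝 t, K (f s) = k - w s)
    (hψ : ∀ᶠ s in 𝓝 t, ψ s = K (g s)) (hw : HasDerivAt w w' t) (hψ' : HasDerivAt ψ ψ' t)
    (hg : ContinuousAt g t) :
    HasDerivAt (fun s => inner ℝ (f s) (ψ s)) (inner ℝ (f t) ψ' - inner ℝ w' (g t)) t := by
  -- By symmetry ⟨f s - f t, K g s⟩ = -⟨w s - w t, g s⟩. The left factor vanishes at s = t, so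
  -- continuity of g suffices.
  have h1 : HasDerivAt (fun s => inner ℝ (w s - w t) (g s)) (inner ℝ w' (g t)) t := by
    rw [hasDerivAt_iff_tendsto_slope]
    have hl : Tendsto (fun s => inner ℝ (slope w t s) (g s)) (𝓝[≠] t) (𝓝 (inner ℝ w' (g t))) :=
      (hasDerivAt_iff_tendsto_slope.1 hw).inner (hg.tendsto.mono_left nhdsWithin_le_nhds)
    refine hl.congr fun s => ?_
    simp [slope_def_module, inner_smul_left]
  have h2 : HasDerivAt (fun s => inner ℝ (f t) (ψ s - ψ t)) (inner ℝ (f t) ψ') t := by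
    simpa using (hasDerivAt_const t (f t)).inner ℝ (hψ'.sub_const (ψ t))
  have h3 := (h2.sub h1).const_add (inner ℝ (f t) (ψ t))
  refine h3.congr_of_eventuallyEq ?_
  filter_upwards [hf, hψ] with s hs1 hs2
  have e : inner ℝ (f s - f t) (ψ s) = -inner ℝ (w s - w t) (g s) := by
    rw [hs2, ← hs, map_sub, hs1, hf.self_of_nhds, ← inner_neg_left]
    congr 1
    abel
  simp only [Pi.sub_apply]
  rw [inner_sub_left] at e
  rw [inner_sub_right]
  linarith

variable [CompleteSpace H]

/-- The integrated form of the product rule for `⟪f, K g⟫` along a mild solution `f`. -/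
lemma integral_inner_eq_of_mild {K : H →L[ℝ] H}
    (hs : ∀ x y, inner ℝ (K x) y = inner ℝ x (K y)) {τ : ℝ} (hτ : 0 ≤ τ) {f y ψ ψ' g : ℝ → H}
    {k : H} (hy : Continuous y) (hfc : ContinuousOn f (Icc 0 τ))
    (hf : ∀ t ∈ Icc 0 τ, K (f t) = k - ∫ s in (0 : ℝ)..t, y s)
    (hψ : ∀ t ∈ Icc 0 τ, ψ t = K (g t)) (hψc : ContinuousOn ψ (Icc 0 τ))
    (hψ' : ∀ t ∈ Ioo 0 τ, HasDerivAt ψ (ψ' t) t) (hψ'c : ContinuousOn ψ' (Icc 0 τ))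
    (hg : ContinuousOn g (Icc 0 τ)) :
    ∫ t in (0 : ℝ)..τ, (inner ℝ (f t) (ψ' t) - inner ℝ (y t) (g t))
      = inner ℝ (f τ) (ψ τ) - inner ℝ (f 0) (ψ 0) := by
  refine intervalIntegral.integral_eq_sub_of_hasDerivAt_of_le
    (f := fun t => inner ℝ (f t) (ψ t)) hτ (hfc.inner hψc) (fun t ht => ?_) ?_
  · have hn : Icc 0 τ ∈ 𝓝 t := Icc_mem_nhds ht.1 ht.2
    refine hasDerivAt_inner_of_apply hs (w := fun t => ∫ s in (0 : ℝ)..t, y s) (k := k) (g := g)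
      ?_ ?_ ?_ (hψ' t ht) (hg.continuousAt hn)
    · filter_upwards [hn] with s hs1 using hf s hs1
    · filter_upwards [hn] with s hs1 using hψ s hs1
    · exact intervalIntegral.integral_hasDerivAt_right (hy.intervalIntegrable _ _)
        (hy.stronglyMeasurableAtFilter _ _) hy.continuousAt
  · refine ContinuousOn.intervalIntegrable ?_
    rw [uIcc_of_le hτ]
    exact (hfc.inner hψ'c).sub (hy.continuousOn.inner hg)

/-- Uniqueness of mild solutions. -/
lemma eq_zero_of_apply_eq_neg_integral {K : H →L[ℝ] H}
    (hs : ∀ x y, inner ℝ (K x) y = inner ℝ x (K y)) (hp : ∀ x, 0 ≤ inner ℝ (K x) x)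
    (hi : ∀ x, inner ℝ (K x) x = 0 → x = 0) {T : ℝ} (hT : 0 ≤ T)
    {f : ℝ → H} (hf : ContinuousOn f (Icc 0 T))
    (h : ∀ t ∈ Icc 0 T, K (f t) = -∫ s in (0 : ℝ)..t, f s) {t : ℝ} (ht : t ∈ Icc 0 T) :
    f t = 0 := by
  set g := IccExtend hT ((Icc 0 T).domRestrict f) with hg
  have hgc : Continuous g := (continuousOn_iff_continuous_domRestrict.1 hf).Icc_extend'
  have hgf (s : ℝ) (hs' : s ∈ Icc 0 T) : g s = f s := IccExtend_of_mem hT _ hs'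
  set w : ℝ → H := fun t => ∫ s in (0 : ℝ)..t, g s with hw
  have hwd (s : ℝ) : HasDerivAt w (g s) s :=
    intervalIntegral.integral_hasDerivAt_right (hgc.intervalIntegrable _ _)
      (hgc.stronglyMeasurableAtFilter _ _) hgc.continuousAt
  have hKw (s : ℝ) (hs' : s ∈ Icc 0 T) : K (g s) = -w s := by
    rw [hgf s hs', h s hs', hw]
    congr 1
    refine intervalIntegral.integral_congr fun r hr => (hgf r ?_).symm
    rw [uIcc_of_le hs'.1] at hr
    exact ⟨hr.1, hr.2.trans hs'.2⟩
  have hd (s : ℝ) : HasDerivAt (fun r => inner ℝ (K (w r)) (w r))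
      (2 * inner ℝ (K (g s)) (w s)) s := by
    refine ((K.hasFDerivAt.comp_hasDerivAt s (hwd s)).inner ℝ (hwd s)).congr_deriv ?_
    simp only [Function.comp_apply]
    rw [hs (w s), real_inner_comm]
    ring
  -- Energy argument: since K w' = -w, the derivative of ⟨Kw, w⟩ is -2‖w‖².
  have hanti : AntitoneOn (fun r => inner ℝ (K (w r)) (w r)) (Icc 0 T) := by
    refine antitoneOn_of_deriv_nonpos (convex_Icc 0 T)
      (fun s _ => (hd s).continuousAt.continuousWithinAt)
      (fun s _ => (hd s).differentiableAt.differentiableWithinAt) fun s hs' => ?_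
    rw [(hd s).deriv, hKw s (interior_subset hs'), inner_neg_left]
    linarith [real_inner_self_nonneg (x := w s)]
  have h1 := hanti ⟨le_rfl, hT⟩ ht ht.1
  have hw0 : w 0 = 0 := by simp [hw]
  simp only [hw0, inner_zero_right] at h1
  have h2 : w t = 0 := hi _ (le_antisymm h1 (hp _))
  refine hi _ ?_
  rw [← hgf t ht, hKw t ht, h2, neg_zero, inner_zero_left]

/-- Existence of mild solutions of `K y' = -(y - u e)`, `y 0 = f₀`, where `u` is the primitive of
an integrable function: superpose translates of the response to the unit step. -/
lemma exists_forced_solution {K : H →L[ℝ] H} (hs : ∀ x y, inner ℝ (K x) y = inner ℝ x (K y))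
    (hp : ∀ x, 0 ≤ inner ℝ (K x) x) (hi : Function.Injective K) {T : ℝ} (hT : 0 ≤ T) (f₀ e : H)
    (c : ℝ) {v : ℝ → ℝ} (hv : Integrable v) (hv0 : ∀ s, s ∉ Ioo 0 T → v s = 0) :
    ∃ f : ℝ → H, Continuous f ∧ f 0 = f₀ ∧ ∀ t ∈ Icc 0 T,
      K (f t) = K f₀ - ∫ s in (0 : ℝ)..t, (f s - (c + ∫ r in (0 : ℝ)..s, v r) • e) := by
  obtain ⟨X, hXc, -, hX0, hX⟩ := exists_homogeneous_solution hs hp hi hT f₀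
  obtain ⟨Y, hYc, hYb, hY0, hY⟩ := exists_homogeneous_solution hs hp hi hT e
  -- Response to the unit step: Z starts at 0 and solves K Z' = -(Z - e) in mild form.
  set Z : ℝ → H := fun t => e - Y t with hZ
  have hZc : Continuous Z := continuous_const.sub hYc
  have hZ0 (t : ℝ) (ht : t ≤ 0) : Z t = 0 := by simp [hZ, hY0 t ht]
  have hZb (t : ℝ) : ‖Z t‖ ≤ 2 * ‖e‖ := (norm_sub_le _ _).trans (by linarith [hYb t])
  -- Cutting Y off at negative times makes K Z(t) = ∫₀ᵗ E valid for every t ≤ T, so all translates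
  -- are treated alike.
  set E : ℝ → H := (Ioi 0).indicator Y with hE
  have hEb (t : ℝ) : ‖E t‖ ≤ ‖e‖ := (norm_indicator_le_norm_self _ _).trans (hYb t)
  have hEm : StronglyMeasurable E := hYc.stronglyMeasurable.indicator measurableSet_Ioi
  have hEi (a b : ℝ) : IntervalIntegrable E volume a b :=
    (intervalIntegrable_const (c := ‖e‖)).mono_fun hEm.aestronglyMeasurable
      (ae_of_all _ fun t => by simpa using hEb t)
  have hKZY (t : ℝ) (ht : t ∈ Icc 0 T) : K (Z t) = ∫ s in (0 : ℝ)..t, Y s := by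
    rw [hZ, map_sub, hY t ht, sub_sub_cancel]
  have hKZ (t : ℝ) (ht : t ≤ T) : K (Z t) = ∫ s in (0 : ℝ)..t, E s := by
    rcases le_total 0 t with h | h
    · rw [hKZY t ⟨h, ht⟩]
      refine intervalIntegral.integral_congr_ae (ae_of_all _ fun s hs' => ?_)
      rw [uIoc_of_le h] at hs'
      exact (indicator_of_mem (show s ∈ Ioi (0 : ℝ) from hs'.1) Y).symm
    · rw [hZ0 t h, map_zero, eq_comm]
      refine intervalIntegral.integral_zero_ae (ae_of_all _ fun s hs' => ?_)
      rw [uIoc_of_ge h] at hs'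
      exact indicator_of_notMem (by simpa using hs'.2) Y
  have hint (t : ℝ) : Integrable fun s => v s • Z (t - s) := by
    refine Integrable.mono' (hv.norm.mul_const (2 * ‖e‖))
      (hv.aestronglyMeasurable.smul (hZc.comp (by fun_prop)).aestronglyMeasurable)
      (ae_of_all _ fun s => ?_)
    rw [norm_smul]
    gcongr
    exact hZb _
  -- Duhamel integral; causality is built in because Z vanishes on (-∞, 0].
  set F : ℝ → H := fun t => ∫ s, v s • Z (t - s) with hF
  have hFc : Continuous F := by
    refine continuous_of_dominated (bound := fun s => ‖v s‖ * (2 * ‖e‖))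
      (fun t => (hint t).aestronglyMeasurable) (fun t => ae_of_all _ fun s => ?_)
      (hv.norm.mul_const _) (ae_of_all _ fun s => ?_)
    · rw [norm_smul]
      gcongr
      exact hZb _
    · exact continuous_const.smul (hZc.comp (by fun_prop))
  have hF0 : F 0 = 0 := by
    refine integral_eq_zero_of_ae (ae_of_all _ fun s => ?_)
    by_cases h : s ∈ Ioo 0 T
    · simp [hZ0 (-s) (by linarith [h.1])]
    · simp [hv0 s h]
  set V : ℝ → ℝ := fun s => ∫ r in (0 : ℝ)..s, v r with hV
  have hVc : Continuous V := intervalIntegral.continuous_primitive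
    (fun a b => hv.intervalIntegrable) 0
  have hinner (r : ℝ) (hr : 0 ≤ r) : ∫ s, v s • E (r - s) = V r • e - F r := by
    have h1 : Integrable fun s => (Iio r).indicator v s • e :=
      (hv.indicator measurableSet_Iio).smul_const e
    have h2 : (fun s => v s • E (r - s))
        = fun s => (Iio r).indicator v s • e - v s • Z (r - s) := by
      funext s
      by_cases hsr : s < r
      · rw [hE, indicator_of_mem (show r - s ∈ Ioi (0 : ℝ) by simpa using hsr),
          indicator_of_mem (show s ∈ Iio r from hsr), ← smul_sub, hZ, sub_sub_cancel]
      · rw [hE, indicator_of_notMem (show r - s ∉ Ioi (0 : ℝ) by simpa using hsr),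
          indicator_of_notMem (show s ∉ Iio r from hsr), hZ0 (r - s) (by linarith)]
        simp
    rw [h2, integral_sub h1 (hint r), integral_smul_const, integral_indicator measurableSet_Iio]
    congr 2
    rw [hV]
    simp only
    rw [intervalIntegral.integral_of_le hr, integral_Ioc_eq_integral_Ioo]
    exact setIntegral_eq_of_subset_of_forall_sdiff_eq_zero measurableSet_Iio
      (s := Ioo 0 r) (fun s hs' => hs'.2) fun s hs' => hv0 s fun h => hs'.2 ⟨h.1, hs'.1⟩
  -- Pass K inside, write each K Z(t - s) as an integral of E(r - s) over r in (0, t), and exchange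
  -- the integrals; `hinner` evaluates the inner one.
  have hKF (t : ℝ) (ht : t ∈ Icc 0 T) : K (F t) = ∫ r in (0 : ℝ)..t, (V r • e - F r) := by
    have h1 : K (F t) = ∫ s, ∫ r in Ioc 0 t, v s • E (r - s) := by
      rw [hF]
      simp only
      rw [← K.integral_comp_comm (hint t)]
      refine integral_congr_ae (ae_of_all _ fun s => ?_)
      simp only [map_smul]
      rw [integral_smul]
      by_cases h : s ∈ Ioo 0 T
      · congr 1
        rw [← intervalIntegral.integral_of_le ht.1, intervalIntegral.integral_comp_sub_right,
          ← intervalIntegral.integral_interval_sub_left (hEi 0 (t - s)) (hEi 0 (0 - s)),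
          ← hKZ _ (by linarith [ht.2, h.1]), ← hKZ (0 - s) (by linarith [h.1]),
          hZ0 (0 - s) (by linarith [h.1]), map_zero, sub_zero]
      · simp [hv0 s h]
    have hprod : Integrable (Function.uncurry fun s r => v s • E (r - s))
        (volume.prod (volume.restrict (Ioc 0 t))) := by
      refine Integrable.mono' (g := fun z : ℝ × ℝ => ‖v z.1‖ * ‖e‖)
        ((hv.norm.comp_fst _).mul_const _) ?_ (ae_of_all _ fun z => ?_)
      · refine (hv.aestronglyMeasurable.comp_fst).smul ?_
        exact (hEm.comp_measurable (measurable_snd.sub measurable_fst)).aestronglyMeasurable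
      · rw [Function.uncurry, norm_smul]
        gcongr
        exact hEb _
    rw [h1, integral_integral_swap hprod, intervalIntegral.integral_of_le ht.1]
    exact setIntegral_congr_fun measurableSet_Ioc fun r hr => hinner r hr.1.le
  refine ⟨fun t => X t + c • Z t + F t, by fun_prop, ?_, fun t ht => ?_⟩
  · simp [hX0 0 le_rfl, hZ0 0 le_rfl, hF0]
  have i1 : IntervalIntegrable X volume 0 t := hXc.intervalIntegrable _ _
  have i2 : IntervalIntegrable (fun s => c • Y s) volume 0 t :=
    (hYc.const_smul c).intervalIntegrable _ _
  have i3 : IntervalIntegrable (fun r => V r • e - F r) volume 0 t :=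
    ((hVc.smul continuous_const).sub hFc).intervalIntegrable _ _
  have e1 : ∫ s in (0 : ℝ)..t, (X s + c • Z s + F s - (c + V s) • e)
      = (∫ s in (0 : ℝ)..t, X s) - c • (∫ s in (0 : ℝ)..t, Y s)
        - ∫ r in (0 : ℝ)..t, (V r • e - F r) := by
    rw [← intervalIntegral.integral_smul, ← intervalIntegral.integral_sub i1 i2,
      ← intervalIntegral.integral_sub (i1.sub i2) i3]
    congr 1
    funext s
    simp only [hZ, smul_sub, add_smul]
    abel
  rw [e1, map_add, map_add, map_smul, hX t ht, hKZY t ht, hKF t ht]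
  abel

end Mild

/-! ### Weak derivatives on an interval and their primitives -/

section WeakDerivative

lemma integrable_mul_of_tsupport_subset {a b : ℝ} {g φ : ℝ → ℝ}
    (hg : LocallyIntegrableOn g (Ioo a b)) (hφ : Continuous φ) (hc : HasCompactSupport φ)
    (hs : tsupport φ ⊆ Ioo a b) :
    Integrable (fun x => g x * φ x) (volume.restrict (Ioo a b)) := by
  have h1 : IntegrableOn g (tsupport φ) := hg.integrableOn_compact_subset hs hc
  have h2 : IntegrableOn (fun x => g x * φ x) (tsupport φ) :=
    h1.mul_continuousOn hφ.continuousOn hc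
  have h3 : Function.support (fun x => g x * φ x) ⊆ tsupport φ := fun x hx =>
    subset_tsupport φ (right_ne_zero_of_mul hx)
  exact ((integrableOn_iff_integrable_of_support_subset h3).1 h2).restrict

lemma ae_eq_zero_of_integral_mul_test_eq_zero {a b : ℝ} {h : ℝ → ℝ}
    (hl : LocallyIntegrableOn h (Ioo a b))
    (H : ∀ φ : ℝ → ℝ, ContDiff ℝ ∞ φ → HasCompactSupport φ → tsupport φ ⊆ Ioo a b →
      ∫ x in Ioo a b, h x * φ x = 0) :
    h =ᵐ[volume.restrict (Ioo a b)] 0 := by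
  have := isOpen_Ioo.ae_eq_zero_of_integral_contDiff_smul_eq_zero hl (fun φ h1 h2 h3 => by
    rw [← H φ h1 h2 h3]
    rw [setIntegral_eq_integral_of_forall_compl_eq_zero]
    · simp only [smul_eq_mul, mul_comm]
    · intro x hx
      rw [image_eq_zero_of_notMem_tsupport fun h => hx (h3 h), mul_zero])
  exact (ae_restrict_iff' measurableSet_Ioo).2 this

lemma HasWeakDeriv.ae_eq {a b : ℝ} {f g g' : ℝ → ℝ} (h : HasWeakDeriv a b f g)
    (h' : HasWeakDeriv a b f g') : g =ᵐ[volume.restrict (Ioo a b)] g' := by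
  have := ae_eq_zero_of_integral_mul_test_eq_zero (h := fun x => g x - g' x)
    (h.2.1.sub h'.2.1) (fun φ h1 h2 h3 => by
      simp only [sub_mul]
      rw [integral_sub (integrable_mul_of_tsupport_subset h.2.1 h1.continuous h2 h3)
        (integrable_mul_of_tsupport_subset h'.2.1 h1.continuous h2 h3)]
      have e1 := h.2.2 φ h1 h2 h3
      have e2 := h'.2.2 φ h1 h2 h3
      linarith)
  filter_upwards [this] with x hx
  simpa [sub_eq_zero] using hx

lemma weakDeriv_ae_eq {a b : ℝ} {f g : ℝ → ℝ} (h : HasWeakDeriv a b f g) :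
    weakDeriv a b f =ᵐ[volume.restrict (Ioo a b)] g := by
  have hex : ∃ g, HasWeakDeriv a b f g := ⟨g, h⟩
  rw [weakDeriv, dif_pos hex]
  exact hex.choose_spec.ae_eq h

/-- Integration by parts for two primitives. -/
lemma integral_primitive_mul {a b : ℝ} {v q : ℝ → ℝ} (hv : IntervalIntegrable v volume a b)
    (hq : IntervalIntegrable q volume a b) :
    ∫ x in a..b, (∫ s in a..x, v s) * q x = -∫ x in a..b, v x * ∫ s in b..x, q s := by
  -- Basing one primitive at a and the other at b kills both boundary terms.
  have h1 := hv.absolutelyContinuousOnInterval_intervalIntegral (c := a) left_mem_uIcc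
  have h2 := hq.absolutelyContinuousOnInterval_intervalIntegral (c := b) right_mem_uIcc
  have h3 := h1.integral_mul_deriv_eq_deriv_mul h2
  simp only [intervalIntegral.integral_same, mul_zero, zero_mul, sub_zero, zero_sub] at h3
  convert h3 using 1
  · refine intervalIntegral.integral_congr_ae ?_
    filter_upwards [hq.ae_hasDerivAt_integral] with x hx hxab
    rw [(hx (uIoc_subset_uIcc hxab) b right_mem_uIcc).deriv]
  · congr 1
    refine intervalIntegral.integral_congr_ae ?_
    filter_upwards [hv.ae_hasDerivAt_integral] with x hx hxab
    rw [(hx (uIoc_subset_uIcc hxab) a left_mem_uIcc).deriv]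

lemma tsupport_deriv_subset_of_subset {φ : ℝ → ℝ} {s : Set ℝ} (h : tsupport φ ⊆ s) :
    tsupport (deriv φ) ⊆ s := tsupport_deriv_subset.trans h

lemma eq_zero_of_tsupport_subset {a b x : ℝ} {φ : ℝ → ℝ} (h : tsupport φ ⊆ Ioo a b)
    (hx : x ∉ Ioo a b) : φ x = 0 :=
  image_eq_zero_of_notMem_tsupport fun hx' => hx (h hx')

/-- Integration by parts against φ', whose primitive based at b is φ; the constant c drops out
because φ' has integral 0. -/
lemma hasWeakDeriv_primitive {a b : ℝ} (hab : a ≤ b) {g : ℝ → ℝ} (c : ℝ)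
    (hg : IntegrableOn g (Ioo a b)) :
    HasWeakDeriv a b (fun x => c + ∫ s in a..x, g s) g := by
  have hgi : IntervalIntegrable g volume a b :=
    (intervalIntegrable_iff_integrableOn_Ioo_of_le hab).2 hg
  have hcont : ContinuousOn (fun x => ∫ s in a..x, g s) (Icc a b) := by
    have := intervalIntegral.continuousOn_primitive_interval
      (show IntegrableOn g (uIcc a b) by
        rw [uIcc_of_le hab, integrableOn_Icc_iff_integrableOn_Ioo]; exact hg)
    rwa [uIcc_of_le hab] at this
  refine ⟨((continuousOn_const.add hcont).mono Ioo_subset_Icc_self).locallyIntegrableOn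
    measurableSet_Ioo, hg.locallyIntegrableOn, fun φ h1 h2 h3 => ?_⟩
  have hd (x : ℝ) : HasDerivAt φ (deriv φ x) x :=
    (h1.differentiable (by simp)).differentiableAt.hasDerivAt
  have hdc : Continuous (deriv φ) := h1.continuous_deriv (by simp)
  have ha := eq_zero_of_tsupport_subset h3 (x := a) (by simp)
  have hb := eq_zero_of_tsupport_subset h3 (x := b) (by simp)
  have e := integral_primitive_mul hgi (hdc.intervalIntegrable (μ := volume) a b)
  have e2 (x : ℝ) : ∫ s in b..x, deriv φ s = φ x := by
    rw [intervalIntegral.integral_eq_sub_of_hasDerivAt (fun s _ => hd s)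
      (hdc.intervalIntegrable _ _), hb, sub_zero]
  have e3 : ∫ s in a..b, deriv φ s = 0 := by
    rw [intervalIntegral.integral_eq_sub_of_hasDerivAt (fun s _ => hd s)
      (hdc.intervalIntegrable _ _), hb, ha, sub_zero]
  simp only [e2] at e
  rw [← integral_Ioc_eq_integral_Ioo, ← integral_Ioc_eq_integral_Ioo,
    ← intervalIntegral.integral_of_le hab, ← intervalIntegral.integral_of_le hab, ← e]
  simp only [add_mul]
  rw [intervalIntegral.integral_add ((hdc.intervalIntegrable _ _).const_mul c),
    intervalIntegral.integral_const_mul, e3, mul_zero, zero_add]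
  refine ContinuousOn.intervalIntegrable ?_
  rw [uIcc_of_le hab]
  exact hcont.mul hdc.continuousOn

lemma exists_test_integral_eq_one {a b : ℝ} (hab : a < b) :
    ∃ ρ : ℝ → ℝ, ContDiff ℝ ∞ ρ ∧ HasCompactSupport ρ ∧ tsupport ρ ⊆ Ioo a b ∧
      ∫ x, ρ x = 1 := by
  let B : ContDiffBump ((a + b) / 2) := ⟨(b - a) / 8, (b - a) / 4, by linarith, by linarith⟩
  refine ⟨B.normed volume, B.contDiff_normed, B.hasCompactSupport_normed, ?_, B.integral_normed⟩
  rw [B.tsupport_normed_eq, Real.closedBall_eq_Icc]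
  change Icc ((a + b) / 2 - (b - a) / 4) ((a + b) / 2 + (b - a) / 4) ⊆ _
  exact fun x hx => ⟨by linarith [hx.1], by linarith [hx.2]⟩

/-- A compactly supported smooth function on `(a, b)` with vanishing integral has a compactly
supported smooth primitive on `(a, b)`. -/
lemma exists_test_primitive {a b : ℝ} {φ : ℝ → ℝ} (h1 : ContDiff ℝ ∞ φ)
    (h2 : HasCompactSupport φ) (h3 : tsupport φ ⊆ Ioo a b) (h0 : ∫ x, φ x = 0) :
    ∃ θ : ℝ → ℝ, ContDiff ℝ ∞ θ ∧ HasCompactSupport θ ∧ tsupport θ ⊆ Ioo a b ∧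
      deriv θ = φ := by
  rcases (tsupport φ).eq_empty_or_nonempty with he | hne
  · refine ⟨0, contDiff_const, HasCompactSupport.zero, by simp, ?_⟩
    rw [tsupport_eq_empty_iff] at he
    rw [he]
    funext x
    simp
  -- The primitive based at the left end c of the support vanishes before c, and after the right end
  -- d because the total integral is 0.
  obtain ⟨c, hc⟩ := h2.isCompact.exists_isLeast hne
  obtain ⟨d, hd⟩ := h2.isCompact.exists_isGreatest hne
  have hφc := h1.continuous
  set θ : ℝ → ℝ := fun x => ∫ s in c..x, φ s with hθ
  have hθd (x : ℝ) : HasDerivAt θ (φ x) x :=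
    intervalIntegral.integral_hasDerivAt_right (hφc.intervalIntegrable _ _)
      (hφc.stronglyMeasurableAtFilter _ _) hφc.continuousAt
  have hder : deriv θ = φ := funext fun x => (hθd x).deriv
  have hlow (x : ℝ) (hx : x < c) : φ x = 0 :=
    image_eq_zero_of_notMem_tsupport fun h => absurd (hc.2 h) (by linarith)
  have hhigh (x : ℝ) (hx : d < x) : φ x = 0 :=
    image_eq_zero_of_notMem_tsupport fun h => absurd (hd.2 h) (by linarith)
  have hcd : c ≤ d := hc.2 hd.1
  have hsupp : Function.support θ ⊆ Icc c d := by
    intro x hx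
    by_contra hn
    rw [mem_Icc, not_and_or, not_le, not_le] at hn
    refine hx ?_
    rcases hn with h | h
    · refine intervalIntegral.integral_zero_ae ?_
      filter_upwards [compl_mem_ae_iff.2 (measure_singleton c)] with s hsc hs
      rw [uIoc_of_ge h.le] at hs
      exact hlow s (lt_of_le_of_ne hs.2 hsc)
    · rw [hθ]
      simp only
      rw [intervalIntegral.integral_of_le (hcd.trans h.le), ← integral_Icc_eq_integral_Ioc,
        setIntegral_eq_integral_of_forall_compl_eq_zero, h0]
      intro s hs
      rw [mem_Icc, not_and_or, not_le, not_le] at hs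
      rcases hs with h' | h'
      · exact hlow s h'
      · exact hhigh s (h.trans h')
  have hts : tsupport θ ⊆ Icc c d := closure_minimal hsupp isClosed_Icc
  refine ⟨θ, ?_, HasCompactSupport.of_support_subset_isCompact isCompact_Icc hsupp, ?_, hder⟩
  · rw [contDiff_infty_iff_deriv, hder]
    exact ⟨fun x => (hθd x).differentiableAt, h1⟩
  · exact hts.trans fun x hx => ⟨(h3 hc.1).1.trans_le hx.1, hx.2.trans_lt (h3 hd.1).2⟩

/-- A function with integrable weak derivative is a.e. equal to a primitive of it. -/
lemma HasWeakDeriv.exists_ae_eq_primitive {a b : ℝ} (hab : a < b) {f g : ℝ → ℝ}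
    (h : HasWeakDeriv a b f g) (hg : IntegrableOn g (Ioo a b)) :
    ∃ c : ℝ, f =ᵐ[volume.restrict (Ioo a b)] fun x => c + ∫ s in a..x, g s := by
  obtain ⟨ρ, hρ1, hρ2, hρ3, hρ4⟩ := exists_test_integral_eq_one hab
  have hG := hasWeakDeriv_primitive hab.le 0 hg
  simp only [zero_add] at hG
  set G : ℝ → ℝ := fun x => ∫ s in a..x, g s
  have hl : LocallyIntegrableOn (fun x => f x - G x) (Ioo a b) := h.1.sub hG.1
  -- Du Bois-Reymond: f - G annihilates derivatives of test functions, in particular φ - (∫φ)ρ, so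
  -- it is its ρ-average c.
  set c : ℝ := ∫ x in Ioo a b, (f x - G x) * ρ x with hc
  refine ⟨c, ?_⟩
  have hlc : LocallyIntegrableOn (fun _ : ℝ => c) (Ioo a b) :=
    continuousOn_const.locallyIntegrableOn measurableSet_Ioo
  have key := ae_eq_zero_of_integral_mul_test_eq_zero (h := fun x => f x - G x - c)
    (hl.sub hlc) (fun φ h1 h2 h3 => by
      set m : ℝ := ∫ x, φ x with hm
      have hφi : Integrable φ := h1.continuous.integrable_of_hasCompactSupport h2
      have hρi : Integrable ρ := hρ1.continuous.integrable_of_hasCompactSupport hρ2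
      have k1 : ContDiff ℝ ∞ (fun x => φ x - m * ρ x) := h1.sub (contDiff_const.mul hρ1)
      have k2 : HasCompactSupport (fun x => φ x - m * ρ x) := h2.sub (hρ2.mul_left)
      have k3 : tsupport (fun x => φ x - m * ρ x) ⊆ Ioo a b := by
        refine (tsupport_sub φ (fun x => m * ρ x)).trans (union_subset h3 ?_)
        exact (tsupport_mul_subset_right).trans hρ3
      have k4 : ∫ x, (φ x - m * ρ x) = 0 := by
        rw [integral_sub hφi (hρi.const_mul m), integral_const_mul, hρ4, mul_one, sub_self]
      obtain ⟨θ, t1, t2, t3, t4⟩ := exists_test_primitive k1 k2 k3 k4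
      have e1 := h.2.2 θ t1 t2 t3
      have e2 := hG.2.2 θ t1 t2 t3
      have i1 := integrable_mul_of_tsupport_subset h.1 (t1.continuous_deriv (by simp)) t2.deriv
        (tsupport_deriv_subset_of_subset t3)
      have i2 := integrable_mul_of_tsupport_subset hG.1 (t1.continuous_deriv (by simp)) t2.deriv
        (tsupport_deriv_subset_of_subset t3)
      have e3 : ∫ x in Ioo a b, (f x - G x) * deriv θ x = 0 := by
        simp only [sub_mul]
        rw [integral_sub i1 i2, e1, e2, sub_self]
      rw [t4] at e3
      have i3 := integrable_mul_of_tsupport_subset hl h1.continuous h2 h3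
      have i4 := integrable_mul_of_tsupport_subset hl hρ1.continuous hρ2 hρ3
      have e4 : ∫ x in Ioo a b, (f x - G x) * (φ x - m * ρ x)
          = (∫ x in Ioo a b, (f x - G x) * φ x) - m * c := by
        rw [hc, ← integral_const_mul, ← integral_sub i3 (i4.const_mul m)]
        congr 1
        funext x
        ring
      have e5 : ∫ x in Ioo a b, φ x = m :=
        setIntegral_eq_integral_of_forall_compl_eq_zero fun x hx =>
          eq_zero_of_tsupport_subset h3 hx
      have e6 : ∫ x in Ioo a b, (f x - G x - c) * φ x
          = (∫ x in Ioo a b, (f x - G x) * φ x) - c * m := by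
        rw [← e5, ← integral_const_mul, ← integral_sub i3 (hφi.restrict.const_mul c)]
        congr 1
        funext x
        ring
      rw [e6]
      linarith)
  filter_upwards [key] with x hx
  have : f x - G x - c = 0 := hx
  linarith

/-- Multiplication of a weakly differentiable function by the weight `x ^ α`. -/
lemma HasWeakDeriv.rpow_mul {α : ℝ} {f g : ℝ → ℝ} (h : HasWeakDeriv 0 1 f g) :
    HasWeakDeriv 0 1 (fun x => x ^ α * f x)
      (fun x => α * x ^ (α - 1) * f x + x ^ α * g x) := by
  have hpc (β : ℝ) : ContinuousOn (fun x : ℝ => x ^ β) (Ioo 0 1) := fun x hx =>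
    (Real.continuousAt_rpow_const x β (Or.inl hx.1.ne')).continuousWithinAt
  have l1 : LocallyIntegrableOn (fun x => x ^ α * f x) (Ioo (0 : ℝ) 1) :=
    h.1.continuousOn_mul (hpc α) isOpen_Ioo.isLocallyClosed
  have l2 : LocallyIntegrableOn (fun x => α * x ^ (α - 1) * f x) (Ioo (0 : ℝ) 1) :=
    h.1.continuousOn_mul (continuousOn_const.mul (hpc (α - 1))) isOpen_Ioo.isLocallyClosed
  have l3 : LocallyIntegrableOn (fun x => x ^ α * g x) (Ioo (0 : ℝ) 1) :=
    h.2.1.continuousOn_mul (hpc α) isOpen_Ioo.isLocallyClosed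
  refine ⟨l1, l2.add l3, fun φ h1 h2 h3 => ?_⟩
  -- The weight is moved onto the test function; χ stays smooth because the support of φ avoids 0.
  set χ : ℝ → ℝ := fun x => x ^ α * φ x with hχ
  have k1 : ContDiff ℝ ∞ χ := by
    rw [contDiff_iff_contDiffAt]
    intro x
    by_cases hx : x ∈ tsupport φ
    · exact (Real.contDiffAt_rpow_const_of_ne (h3 hx).1.ne').mul h1.contDiffAt
    · have : χ =ᶠ[𝓝 x] fun _ => 0 := by
        filter_upwards [notMem_tsupport_iff_eventuallyEq.1 hx] with y hy
        simp [hχ, hy]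
      exact contDiffAt_const.congr_of_eventuallyEq this
  have k2 : HasCompactSupport χ := h2.mul_left
  have k3 : tsupport χ ⊆ Ioo 0 1 := (tsupport_mul_subset_right).trans h3
  have kd : ∀ x ∈ Ioo (0 : ℝ) 1, deriv χ x = α * x ^ (α - 1) * φ x + x ^ α * deriv φ x :=
    fun x hx => ((Real.hasDerivAt_rpow_const (Or.inl hx.1.ne')).mul
      (h1.differentiable (by simp)).differentiableAt.hasDerivAt).deriv
  have e := h.2.2 χ k1 k2 k3
  have i1 := integrable_mul_of_tsupport_subset h.1 (k1.continuous_deriv (by simp)) k2.deriv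
    (tsupport_deriv_subset_of_subset k3)
  have i2 := integrable_mul_of_tsupport_subset l2 h1.continuous h2 h3
  have i3 := integrable_mul_of_tsupport_subset l3 h1.continuous h2 h3
  have e1 : ∫ x in Ioo (0 : ℝ) 1, x ^ α * f x * deriv φ x
      = ∫ x in Ioo (0 : ℝ) 1, (f x * deriv χ x - α * x ^ (α - 1) * f x * φ x) := by
    refine setIntegral_congr_fun measurableSet_Ioo fun x hx => ?_
    simp only [kd x hx]
    ring
  have e2 : ∫ x in Ioo (0 : ℝ) 1, x ^ α * g x * φ x = ∫ x in Ioo (0 : ℝ) 1, g x * χ x := by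
    refine setIntegral_congr_fun measurableSet_Ioo fun x _ => ?_
    simp only [hχ]
    ring
  simp only [add_mul]
  rw [e1, integral_sub i1 i2, integral_add i2 i3, e2, e]
  ring

end WeakDerivative

/-! ### The Hardy operator and the Green operator K -/

section Operators

lemma L2.inner_eq (f g : L2) : inner ℝ f g = ∫ x in Ioo (0 : ℝ) 1, f x * g x := by
  rw [MeasureTheory.L2.inner_def]
  refine integral_congr_ae (ae_of_all _ fun x => ?_)
  simp [mul_comm]

lemma L2.integrableOn (f : L2) : IntegrableOn (f : ℝ → ℝ) (Ioo (0 : ℝ) 1) :=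
  (Lp.memLp f).integrable (by norm_num)

lemma L2.intervalIntegrable (f : L2) : IntervalIntegrable f volume 0 1 :=
  (intervalIntegrable_iff_integrableOn_Ioo_of_le zero_le_one).2 f.integrableOn

lemma L2.intervalIntegrable_of_mem (f : L2) {x : ℝ} (hx : x ∈ Icc (0 : ℝ) 1) :
    IntervalIntegrable f volume 0 x :=
  f.intervalIntegrable.mono_set (by
    rw [uIcc_of_le hx.1, uIcc_of_le zero_le_one]
    exact Icc_subset_Icc_right hx.2)

lemma L2.continuousOn_primitive (f : L2) :
    ContinuousOn (fun x => ∫ s in (0 : ℝ)..x, f s) (Icc 0 1) := by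
  have := intervalIntegral.continuousOn_primitive_interval
    (show IntegrableOn f (uIcc (0 : ℝ) 1) by
      rw [uIcc_of_le zero_le_one, integrableOn_Icc_iff_integrableOn_Ioo]; exact f.integrableOn)
  rwa [uIcc_of_le zero_le_one] at this

/-- The primitive of the a.e. class depends only on the class. -/
lemma primitive_congr {f g : ℝ → ℝ} (h : f =ᵐ[volume.restrict (Ioo (0 : ℝ) 1)] g) {x : ℝ}
    (hx : x ∈ Icc (0 : ℝ) 1) : ∫ s in (0 : ℝ)..x, f s = ∫ s in (0 : ℝ)..x, g s := by
  rw [intervalIntegral.integral_of_le hx.1, intervalIntegral.integral_of_le hx.1,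
    integral_Ioc_eq_integral_Ioo, integral_Ioc_eq_integral_Ioo]
  exact integral_congr_ae (ae_restrict_of_ae_restrict_of_subset (Ioo_subset_Ioo_right hx.2) h)

/-- Cauchy–Schwarz against the indicator of (0, x), whose norm is x^{1/2}. -/
lemma L2.abs_primitive_le (v : L2) {x : ℝ} (hx : x ∈ Ioo (0 : ℝ) 1) :
    |∫ s in (0 : ℝ)..x, v s| ≤ x ^ (1 / 2 : ℝ) * ‖v‖ := by
  have hm : (volume.restrict (Ioo (0 : ℝ) 1)).restrict (Ioo 0 x) = volume.restrict (Ioo 0 x) := by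
    rw [Measure.restrict_restrict measurableSet_Ioo, inter_eq_left.2 (Ioo_subset_Ioo_right hx.2.le)]
  have hfin : (volume.restrict (Ioo (0 : ℝ) 1)) (Ioo 0 x) ≠ ⊤ := measure_ne_top _ _
  have e := MeasureTheory.L2.inner_indicatorConstLp_one (𝕜 := ℝ) measurableSet_Ioo hfin v
  rw [hm] at e
  rw [intervalIntegral.integral_of_le hx.1.le, integral_Ioc_eq_integral_Ioo, ← e]
  refine (abs_real_inner_le_norm _ _).trans (le_of_eq ?_)
  rw [norm_indicatorConstLp (by norm_num) (by norm_num)]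
  congr 1
  rw [Measure.real, Measure.restrict_apply measurableSet_Ioo,
    inter_eq_left.2 (Ioo_subset_Ioo_right hx.2.le)]
  simp [hx.1.le]

lemma memLp_rpow {β : ℝ} (hβ : -1 / 2 < β) :
    MemLp (fun x : ℝ => x ^ β) 2 (volume.restrict (Ioo (0 : ℝ) 1)) := by
  have hc : AEStronglyMeasurable (fun x : ℝ => x ^ β) (volume.restrict (Ioo (0 : ℝ) 1)) :=
    (measurable_id.pow_const β).aestronglyMeasurable
  rw [memLp_two_iff_integrable_sq hc]
  have h := (intervalIntegrable_iff_integrableOn_Ioo_of_le zero_le_one).1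
    (intervalIntegral.intervalIntegrable_rpow' (a := 0) (b := 1) (r := β * 2) (by linarith))
  refine (integrableOn_congr_fun (fun x hx => ?_) measurableSet_Ioo).1 h
  rw [Real.rpow_mul hx.1.le]
  norm_cast

lemma norm_weightedPrimitive_le {α : ℝ} (v : L2) {x : ℝ} (hx : x ∈ Ioo (0 : ℝ) 1) :
    ‖x ^ (-(α / 2)) * ∫ s in (0 : ℝ)..x, v s‖ ≤ ‖v‖ * ‖x ^ ((1 - α) / 2)‖ := by
  have h0 (β : ℝ) : 0 ≤ x ^ β := Real.rpow_nonneg hx.1.le _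
  rw [norm_mul, Real.norm_of_nonneg (h0 _), Real.norm_of_nonneg (h0 _), Real.norm_eq_abs]
  calc _ ≤ x ^ (-(α / 2)) * (x ^ (1 / 2 : ℝ) * ‖v‖) := by
        gcongr
        · exact h0 _
        · exact v.abs_primitive_le hx
    _ = ‖v‖ * x ^ ((1 - α) / 2) := by
        rw [← mul_assoc, ← Real.rpow_add hx.1, mul_comm]
        congr 2
        ring

/-- The dominating function x^{(1-α)/2} is square integrable exactly because 1 - α > -1. -/
lemma memLp_weightedPrimitive {α : ℝ} (hα : α < 2) (v : L2) :
    MemLp (fun x : ℝ => x ^ (-(α / 2)) * ∫ s in (0 : ℝ)..x, v s) 2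
      (volume.restrict (Ioo (0 : ℝ) 1)) := by
  refine MemLp.of_le_mul (memLp_rpow (β := (1 - α) / 2) (by linarith)) (c := ‖v‖) ?_
    ((ae_restrict_iff' measurableSet_Ioo).2 (ae_of_all _ fun x hx =>
      norm_weightedPrimitive_le v hx))
  exact ((measurable_id.pow_const _).aestronglyMeasurable).mul
    ((v.continuousOn_primitive.mono Ioo_subset_Icc_self).aestronglyMeasurable measurableSet_Ioo)

/-- The weighted Hardy operator `v ↦ x^{-α/2} ∫₀ˣ v` on `L²(0, 1)`. -/
def hardy (α : ℝ) (hα : α < 2) : L2 →L[ℝ] L2 :=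
  LinearMap.mkContinuous
    { toFun := fun v => (memLp_weightedPrimitive hα v).toLp
      map_add' := fun v w => by
        rw [← MemLp.toLp_add]
        refine MemLp.toLp_congr _ _ ((ae_restrict_iff' measurableSet_Ioo).2
          (ae_of_all _ fun x hx => ?_))
        have hx' := Ioo_subset_Icc_self hx
        simp only [Pi.add_apply]
        rw [primitive_congr (Lp.coeFn_add v w) hx']
        simp only [Pi.add_apply]
        rw [intervalIntegral.integral_add (v.intervalIntegrable_of_mem hx')
          (w.intervalIntegrable_of_mem hx'), mul_add]
      map_smul' := fun c v => by
        rw [RingHom.id_apply, ← MemLp.toLp_const_smul]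
        refine MemLp.toLp_congr _ _ ((ae_restrict_iff' measurableSet_Ioo).2
          (ae_of_all _ fun x hx => ?_))
        simp only [Pi.smul_apply, smul_eq_mul]
        rw [primitive_congr (Lp.coeFn_smul c v) (Ioo_subset_Icc_self hx)]
        simp only [Pi.smul_apply, smul_eq_mul]
        rw [intervalIntegral.integral_const_mul]
        ring }
    ‖(memLp_rpow (β := (1 - α) / 2) (by linarith)).toLp‖
    (fun v => by
      refine le_of_le_of_eq (Lp.norm_le_mul_norm_of_ae_le_mul ?_) (mul_comm _ _)
      filter_upwards [(memLp_weightedPrimitive hα v).coeFn_toLp,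
        (memLp_rpow (β := (1 - α) / 2) (by linarith)).coeFn_toLp,
        ae_restrict_mem measurableSet_Ioo] with x h1 h2 hx
      simp only [LinearMap.coe_mk, AddHom.coe_mk]
      rw [h1, h2]
      exact norm_weightedPrimitive_le v hx)

lemma hardy_ae_eq {α : ℝ} (hα : α < 2) (v : L2) : hardy α hα v
    =ᵐ[volume.restrict (Ioo (0 : ℝ) 1)] fun x => x ^ (-(α / 2)) * ∫ s in (0 : ℝ)..x, v s :=
  (memLp_weightedPrimitive hα v).coeFn_toLp

/-- The inverse of `-∂ₓ(x^α ∂ₓ)` with the boundary conditions of the problem. -/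
def green (α : ℝ) (hα : α < 2) : L2 →L[ℝ] L2 :=
  ContinuousLinearMap.adjoint (hardy α hα) ∘L hardy α hα

section

variable {α : ℝ} (hα : α < 2)

/-- The quadratic form of K is ∫ x^{-α} (∫₀ˣ v)(∫₀ˣ w); symmetry, positivity and definiteness are
read off from it. -/
lemma inner_green (v w : L2) :
    inner ℝ (green α hα v) w = inner ℝ (hardy α hα v) (hardy α hα w) := by
  rw [green, ContinuousLinearMap.comp_apply, ContinuousLinearMap.adjoint_inner_left]

lemma inner_green_symm (v w : L2) : inner ℝ (green α hα v) w = inner ℝ v (green α hα w) := by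
  rw [inner_green, ← real_inner_comm, ← inner_green, real_inner_comm]

lemma inner_green_nonneg (v : L2) : 0 ≤ inner ℝ (green α hα v) v := by
  rw [inner_green]
  exact real_inner_self_nonneg

/-- Both v and 0 are weak derivatives of the primitive, so they agree almost everywhere. -/
lemma eq_zero_of_primitive_ae_eq_zero {v : L2}
    (h : ∀ᵐ x ∂volume.restrict (Ioo (0 : ℝ) 1), ∫ s in (0 : ℝ)..x, v s = 0) : v = 0 := by
  have h1 := hasWeakDeriv_primitive zero_le_one 0 v.integrableOn
  have h2 : HasWeakDeriv 0 1 (fun x => 0 + ∫ s in (0 : ℝ)..x, v s) 0 := by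
    refine ⟨h1.1, continuousOn_const.locallyIntegrableOn measurableSet_Ioo, fun φ _ _ _ => ?_⟩
    have : ∫ x in Ioo (0 : ℝ) 1, (0 + ∫ s in (0 : ℝ)..x, v s) * deriv φ x = 0 := by
      refine integral_eq_zero_of_ae ?_
      filter_upwards [h] with x hx
      simp [hx]
    rw [this]
    simp
  exact (Lp.eq_zero_iff_ae_eq_zero).2 (h1.ae_eq h2)

lemma eq_zero_of_inner_green_eq_zero (v : L2) (h : inner ℝ (green α hα v) v = 0) : v = 0 := by
  rw [inner_green] at h
  have h1 := inner_self_eq_zero.1 h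
  refine eq_zero_of_primitive_ae_eq_zero ?_
  filter_upwards [hardy_ae_eq hα v, (Lp.eq_zero_iff_ae_eq_zero).1 h1,
    ae_restrict_mem measurableSet_Ioo] with x e1 e2 hx
  rw [e2] at e1
  have := (Real.rpow_pos_of_pos hx.1 (-(α / 2))).ne'
  simpa [this] using e1.symm

lemma green_injective : Function.Injective (green α hα) := by
  rw [injective_iff_map_eq_zero]
  intro v hv
  refine eq_zero_of_inner_green_eq_zero hα v ?_
  rw [hv, inner_zero_left]

end

/-! ### The differential operator D on H² and boundary values -/

lemma memLp_rpow_mul {β : ℝ} (hβ : 0 ≤ β) (v : L2) :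
    MemLp (fun x : ℝ => x ^ β * v x) 2 (volume.restrict (Ioo (0 : ℝ) 1)) ∧
    ∀ᵐ x ∂volume.restrict (Ioo (0 : ℝ) 1), ‖x ^ β * v x‖ ≤ 1 * ‖v x‖ := by
  have h : ∀ᵐ x ∂volume.restrict (Ioo (0 : ℝ) 1), ‖x ^ β * v x‖ ≤ 1 * ‖v x‖ := by
    refine (ae_restrict_iff' measurableSet_Ioo).2 (ae_of_all _ fun x hx => ?_)
    rw [norm_mul, Real.norm_of_nonneg (Real.rpow_nonneg hx.1.le _)]
    gcongr
    exact Real.rpow_le_one hx.1.le hx.2.le hβ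
  exact ⟨MemLp.of_le_mul (Lp.memLp v) ((measurable_id.pow_const _).aestronglyMeasurable.mul
    (Lp.memLp v).aestronglyMeasurable) h, h⟩

/-- Multiplication by `x ^ β` on `L²(0, 1)`. -/
def rpowMul (β : ℝ) (hβ : 0 ≤ β) : L2 →L[ℝ] L2 :=
  LinearMap.mkContinuous
    { toFun := fun v => (memLp_rpow_mul hβ v).1.toLp
      map_add' := fun v w => by
        rw [← MemLp.toLp_add]
        refine MemLp.toLp_congr _ _ ?_
        filter_upwards [Lp.coeFn_add v w] with x hx
        simp only [hx, Pi.add_apply, mul_add]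
      map_smul' := fun c v => by
        rw [RingHom.id_apply, ← MemLp.toLp_const_smul]
        refine MemLp.toLp_congr _ _ ?_
        filter_upwards [Lp.coeFn_smul c v] with x hx
        simp only [hx, Pi.smul_apply, smul_eq_mul]
        ring }
    1
    (fun v => by
      refine Lp.norm_le_mul_norm_of_ae_le_mul ?_
      filter_upwards [(memLp_rpow_mul hβ v).1.coeFn_toLp, (memLp_rpow_mul hβ v).2] with x h1 h2
      simp only [LinearMap.coe_mk, AddHom.coe_mk]
      rwa [h1])

lemma rpowMul_ae_eq {β : ℝ} (hβ : 0 ≤ β) (v : L2) :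
    rpowMul β hβ v =ᵐ[volume.restrict (Ioo (0 : ℝ) 1)] fun x => x ^ β * v x :=
  (memLp_rpow_mul hβ v).1.coeFn_toLp

/-- The degenerate operator `p ↦ ∂ₓ(x^α ∂ₓ p)` from `H²(0, 1)` to `L²(0, 1)`. -/
def degenerateOp (α : ℝ) (hα : 1 ≤ α) (p : H2) : L2 :=
  α • rpowMul (α - 1) (by linarith) p.1.2.1 + rpowMul α (by linarith) p.1.2.2

/-- For α ≥ 1 the weights x^{α-1} and x^α are bounded on (0, 1). This makes t ↦ Dψ(t) continuous for
test functions ψ. -/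
lemma continuous_degenerateOp (α : ℝ) (hα : 1 ≤ α) : Continuous (degenerateOp α hα) := by
  unfold degenerateOp
  fun_prop

lemma degenerateOp_ae_eq {α : ℝ} (hα : 1 ≤ α) (p : H2) :
    degenerateOp α hα p =ᵐ[volume.restrict (Ioo (0 : ℝ) 1)]
      fun x => α * x ^ (α - 1) * p.1.2.1 x + x ^ α * p.1.2.2 x := by
  unfold degenerateOp
  filter_upwards [Lp.coeFn_add (α • rpowMul (α - 1) (by linarith) p.1.2.1)
      (rpowMul α (by linarith) p.1.2.2),
    Lp.coeFn_smul α (rpowMul (α - 1) (by linarith) p.1.2.1),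
    rpowMul_ae_eq (show 0 ≤ α - 1 by linarith) p.1.2.1,
    rpowMul_ae_eq (show 0 ≤ α by linarith) p.1.2.2] with x h1 h2 h3 h4
  rw [h1, Pi.add_apply, h2, Pi.smul_apply, h3, h4, smul_eq_mul, mul_assoc]

lemma HasWeakDeriv.congr_ae {a b : ℝ} {f f' g g' : ℝ → ℝ} (h : HasWeakDeriv a b f g)
    (hf : f =ᵐ[volume.restrict (Ioo a b)] f') (hg : g =ᵐ[volume.restrict (Ioo a b)] g')
    (lf : LocallyIntegrableOn f' (Ioo a b)) (lg : LocallyIntegrableOn g' (Ioo a b)) :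
    HasWeakDeriv a b f' g' := by
  refine ⟨lf, lg, fun φ h1 h2 h3 => ?_⟩
  have e1 : ∫ x in Ioo a b, f x * deriv φ x = ∫ x in Ioo a b, f' x * deriv φ x := by
    refine integral_congr_ae ?_
    filter_upwards [hf] with x hx
    rw [hx]
  have e2 : ∫ x in Ioo a b, g x * φ x = ∫ x in Ioo a b, g' x * φ x := by
    refine integral_congr_ae ?_
    filter_upwards [hg] with x hx
    rw [hx]
  rw [← e1, ← e2, h.2.2 φ h1 h2 h3]

lemma hasWeakDeriv_flux {α : ℝ} (hα : 1 ≤ α) (p : H2) :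
    HasWeakDeriv 0 1 (fun y => y ^ α * dx p y) (degenerateOp α hα p) := by
  have h : HasWeakDeriv 0 1 (dx p) p.1.2.2 := p.2.2
  have h' := h.rpow_mul (α := α)
  exact h'.congr_ae EventuallyEq.rfl (degenerateOp_ae_eq hα p).symm h'.1
    (L2.locallyIntegrableOn _)

lemma integral_mul_add_weakDeriv {α : ℝ} (hα : 1 ≤ α) (f a : L2) (p : H2) :
    ∫ x in Ioo (0 : ℝ) 1, f x * (a x + weakDeriv 0 1 (fun y => y ^ α * dx p y) x)
      = inner ℝ f (a + degenerateOp α hα p) := by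
  rw [L2.inner_eq]
  refine integral_congr_ae ?_
  filter_upwards [weakDeriv_ae_eq (hasWeakDeriv_flux hα p),
    Lp.coeFn_add a (degenerateOp α hα p)] with x h1 h2
  rw [h1, h2, Pi.add_apply]

lemma eqOn_Icc_of_ae_eq {f g : ℝ → ℝ} (hf : ContinuousOn f (Icc 0 1))
    (hg : ContinuousOn g (Icc 0 1)) (h : f =ᵐ[volume.restrict (Ioo (0 : ℝ) 1)] g) :
    EqOn f g (Icc 0 1) := by
  rw [Measure.restrict_congr_set Ioo_ae_eq_Icc] at h
  exact Measure.eqOn_Icc_of_ae_eq volume zero_ne_one h hf hg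

lemma contRep_eqOn {f g : ℝ → ℝ} (hg : ContinuousOn g (Icc 0 1))
    (h : f =ᵐ[volume.restrict (Ioo (0 : ℝ) 1)] g) : EqOn (contRep f) g (Icc 0 1) := by
  have hex : ∃ g : ℝ → ℝ, ContinuousOn g (Icc 0 1) ∧ f =ᵐ[volume.restrict (Ioo (0 : ℝ) 1)] g :=
    ⟨g, hg, h⟩
  rw [contRep, dif_pos hex]
  exact eqOn_Icc_of_ae_eq hex.choose_spec.1 hg (hex.choose_spec.2.symm.trans h)

/-- The continuous representative of a weakly differentiable function in `L²(0, 1)`. -/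
lemma contRep_spec {f g : L2} (h : HasWeakDeriv 0 1 f g) :
    ContinuousOn (contRep f) (Icc 0 1) ∧ f =ᵐ[volume.restrict (Ioo (0 : ℝ) 1)] contRep f ∧
      ∀ x ∈ Icc (0 : ℝ) 1, contRep f x = contRep f 1 + ∫ s in (1 : ℝ)..x, g s := by
  obtain ⟨c, hc⟩ := h.exists_ae_eq_primitive zero_lt_one g.integrableOn
  have hcont : ContinuousOn (fun x => c + ∫ s in (0 : ℝ)..x, g s) (Icc 0 1) :=
    continuousOn_const.add g.continuousOn_primitive
  have heq := contRep_eqOn hcont hc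
  refine ⟨hcont.congr heq, ?_, fun x hx => ?_⟩
  · filter_upwards [hc, ae_restrict_mem measurableSet_Ioo] with x h1 h2
    rw [h1, heq (Ioo_subset_Icc_self h2)]
  · rw [heq hx, heq (right_mem_Icc.2 zero_le_one), add_assoc,
      intervalIntegral.integral_add_adjacent_intervals g.intervalIntegrable
        (g.intervalIntegrable.symm.trans (g.intervalIntegrable_of_mem hx))]

/-- The flux is a primitive of Dp up to a constant; since p' is continuous up to 0 and 0^α = 0,
evaluation at 0 shows that the constant is 0. -/
lemma rpow_mul_contRep_dx {α : ℝ} (hα : 1 ≤ α) (p : H2) {x : ℝ} (hx : x ∈ Icc (0 : ℝ) 1) :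
    x ^ α * contRep (dx p) x = ∫ s in (0 : ℝ)..x, degenerateOp α hα p s := by
  obtain ⟨hc, hae, -⟩ := contRep_spec (show HasWeakDeriv 0 1 (dx p) p.1.2.2 from p.2.2)
  obtain ⟨c, hc'⟩ := (hasWeakDeriv_flux hα p).exists_ae_eq_primitive zero_lt_one
    (degenerateOp α hα p).integrableOn
  have hpc : Continuous fun x : ℝ => x ^ α := Real.continuous_rpow_const (by linarith)
  have heq := eqOn_Icc_of_ae_eq (f := fun x => x ^ α * contRep (dx p) x)
    (g := fun x => c + ∫ s in (0 : ℝ)..x, degenerateOp α hα p s) (hpc.continuousOn.mul hc)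
    (continuousOn_const.add (degenerateOp α hα p).continuousOn_primitive) (by
      filter_upwards [hae, hc'] with x h1 h2
      rw [← h1, h2])
  have h0 := heq (left_mem_Icc.2 zero_le_one)
  simp only [intervalIntegral.integral_same, add_zero,
    Real.zero_rpow (show α ≠ 0 by linarith), zero_mul] at h0
  have h1 := heq hx
  simp only [← h0, zero_add] at h1
  exact h1

/-- The constant function `1` in `L²(0, 1)`. -/
def one : L2 := Lp.const 2 (volume.restrict (Ioo (0 : ℝ) 1)) (1 : ℝ)

lemma inner_one (v : L2) : inner ℝ one v = ∫ s in (0 : ℝ)..1, v s := by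
  rw [L2.inner_eq, intervalIntegral.integral_of_le zero_le_one, integral_Ioc_eq_integral_Ioo]
  refine integral_congr_ae ?_
  filter_upwards [Lp.coeFn_const 2 (volume.restrict (Ioo (0 : ℝ) 1)) (1 : ℝ)] with x hx
  rw [one, hx]
  simp

/-- The flux formula at x = 1. It turns the boundary term u(t) ∂ₓψ(t,1) into ⟨u(t)·1, Dψ(t)⟩. -/
lemma contRep_dx_one {α : ℝ} (hα : 1 ≤ α) (p : H2) :
    contRep (dx p) 1 = inner ℝ one (degenerateOp α hα p) := by
  have := rpow_mul_contRep_dx hα p (right_mem_Icc.2 zero_le_one)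
  rwa [Real.one_rpow, one_mul, ← inner_one] at this

lemma tendsto_flux {α : ℝ} (hα : 1 ≤ α) (p : H2) :
    Tendsto (fun x : ℝ => x ^ α * contRep (dx p) x) (𝓝[>] 0) (𝓝 0) := by
  have hc := (degenerateOp α hα p).continuousOn_primitive 0 (left_mem_Icc.2 zero_le_one)
  have h1 : Tendsto (fun x => ∫ s in (0 : ℝ)..x, degenerateOp α hα p s) (𝓝[>] 0) (𝓝 0) := by
    have := hc.tendsto
    rw [intervalIntegral.integral_same] at this
    refine this.mono_left ?_
    rw [← nhdsWithin_Ioo_eq_nhdsGT zero_lt_one]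
    exact nhdsWithin_mono _ Ioo_subset_Icc_self
  refine h1.congr' ?_
  filter_upwards [Ioo_mem_nhdsGT (zero_lt_one (α := ℝ))] with x hx
  exact (rpow_mul_contRep_dx hα p (Ioo_subset_Icc_self hx)).symm

/-- `green` inverts `-∂ₓ(x^α ∂ₓ)` on the functions of `H²(0, 1)` that vanish at `1`. -/
lemma green_neg_degenerateOp {α : ℝ} (hα : 1 ≤ α) (hα' : α < 2) {p : H2}
    (hp : contRep (toL2 p) 1 = 0) : green α hα' (-degenerateOp α hα p) = toL2 p := by
  have h1 : HasWeakDeriv 0 1 (toL2 p) (dx p) := p.2.1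
  obtain ⟨-, hae, hP⟩ := contRep_spec h1
  obtain ⟨-, hae', -⟩ := contRep_spec (show HasWeakDeriv 0 1 (dx p) p.1.2.2 from p.2.2)
  -- Against v, the weights cancel and leave -∫ p' ∫₀ˣ v. Parts then give ∫ p v, because p(1) = 0
  -- makes p the primitive of p' based at 1.
  refine ext_inner_right ℝ fun v => ?_
  rw [inner_green, map_neg, inner_neg_left, L2.inner_eq, L2.inner_eq]
  have e1 : ∫ x in Ioo (0 : ℝ) 1, hardy α hα' (degenerateOp α hα p) x * hardy α hα' v x
      = ∫ x in (0 : ℝ)..1, (∫ s in (0 : ℝ)..x, v s) * dx p x := by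
    rw [intervalIntegral.integral_of_le zero_le_one, integral_Ioc_eq_integral_Ioo]
    refine integral_congr_ae ?_
    filter_upwards [hardy_ae_eq hα' (degenerateOp α hα p), hardy_ae_eq hα' v, hae',
      ae_restrict_mem measurableSet_Ioo] with x h1 h2 h3 hx
    rw [h1, h2, h3, ← rpow_mul_contRep_dx hα p (Ioo_subset_Icc_self hx)]
    have : x ^ (-(α / 2)) * x ^ α * x ^ (-(α / 2)) = 1 := by
      rw [← Real.rpow_add hx.1, ← Real.rpow_add hx.1]
      ring_nf
      exact Real.rpow_zero _
    linear_combination (contRep (dx p) x * ∫ s in (0 : ℝ)..x, v s) * this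
  rw [e1, integral_primitive_mul v.intervalIntegrable (dx p).intervalIntegrable, neg_neg,
    intervalIntegral.integral_of_le zero_le_one, integral_Ioc_eq_integral_Ioo]
  refine integral_congr_ae ?_
  filter_upwards [hae, ae_restrict_mem measurableSet_Ioo] with x h2 hx
  rw [h2, hP x (Ioo_subset_Icc_self hx), hp, zero_add, mul_comm]

end Operators

/-! ### Test functions, uniqueness and existence of weak solutions -/

section WellPosedness

lemma memLp_of_continuous {f : ℝ → ℝ} (hf : Continuous f) :
    MemLp f 2 (volume.restrict (Ioo (0 : ℝ) 1)) := by
  obtain ⟨C, hC⟩ := isCompact_Icc.exists_bound_of_continuousOn (s := Icc (0 : ℝ) 1)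
    hf.continuousOn
  exact MemLp.of_bound hf.aestronglyMeasurable C ((ae_restrict_iff' measurableSet_Ioo).2
    (ae_of_all _ fun x hx => hC x (Ioo_subset_Icc_self hx)))

lemma hasWeakDeriv_toLp {f g : ℝ → ℝ} (hd : ∀ x, HasDerivAt f (g x) x) (hg : Continuous g)
    (hf : Continuous f) :
    HasWeakDeriv 0 1 (memLp_of_continuous hf).toLp (memLp_of_continuous hg).toLp := by
  have hgi : IntegrableOn g (Ioo 0 1) := (memLp_of_continuous hg).integrable (by norm_num)
  refine (hasWeakDeriv_primitive zero_le_one (f 0) hgi).congr_ae ?_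
    (memLp_of_continuous hg).coeFn_toLp.symm (L2.locallyIntegrableOn _) (L2.locallyIntegrableOn _)
  filter_upwards [(memLp_of_continuous hf).coeFn_toLp] with x hx
  rw [hx, intervalIntegral.integral_eq_sub_of_hasDerivAt (fun s _ => hd s)
    (hg.intervalIntegrable _ _)]
  ring

/-- The flux equation `∂ₓ(x^α q) = -φ` has a smooth solution `q` if `φ` is supported in
`(0, 1)`. -/
lemma exists_smooth_flux (α : ℝ) {φ : ℝ → ℝ} (h1 : ContDiff ℝ ∞ φ) (h3 : tsupport φ ⊆ Ioo 0 1) :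
    ∃ q : ℝ → ℝ, ContDiff ℝ ∞ q ∧
      ∀ x > 0, α * x ^ (α - 1) * q x + x ^ α * deriv q x = -φ x := by
  have hφc := h1.continuous
  set Φ : ℝ → ℝ := fun x => ∫ s in (0 : ℝ)..x, φ s with hΦ
  have hd (x : ℝ) : HasDerivAt Φ (φ x) x :=
    intervalIntegral.integral_hasDerivAt_right (hφc.intervalIntegrable _ _)
      (hφc.stronglyMeasurableAtFilter _ _) hφc.continuousAt
  have hΦs : ContDiff ℝ ∞ Φ := by
    rw [contDiff_infty_iff_deriv, show deriv Φ = φ from funext fun x => (hd x).deriv]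
    exact ⟨fun x => (hd x).differentiableAt, h1⟩
  have h0 : (0 : ℝ) ∉ tsupport φ := fun h => lt_irrefl _ (h3 h).1
  obtain ⟨ε, hε, hε'⟩ := Metric.eventually_nhds_iff.1 (notMem_tsupport_iff_eventuallyEq.1 h0)
  have hφ0 (x : ℝ) (hx : x < ε) : φ x = 0 := by
    rcases le_or_gt x 0 with h | h
    · exact eq_zero_of_tsupport_subset h3 fun h' => absurd h'.1 (not_lt.2 h)
    · exact hε' (by rwa [Real.dist_eq, sub_zero, abs_of_pos h])
  have hΦ0 (x : ℝ) (hx : x < ε) : Φ x = 0 := by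
    refine intervalIntegral.integral_zero_ae (ae_of_all _ fun s hs => hφ0 s ?_)
    exact hs.2.trans_lt (max_lt hε hx)
  -- The singularity of x^{-α} is harmless: Φ vanishes on (-∞, ε).
  set q : ℝ → ℝ := fun x => -(x ^ (-α) * Φ x) with hq
  have hqs : ContDiff ℝ ∞ q := by
    rw [contDiff_iff_contDiffAt]
    intro x
    rcases lt_or_ge x ε with h | h
    · have : q =ᶠ[𝓝 x] fun _ => 0 := by
        filter_upwards [Iio_mem_nhds h] with y hy
        simp [hq, hΦ0 y hy]
      exact contDiffAt_const.congr_of_eventuallyEq this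
    · exact ((Real.contDiffAt_rpow_const_of_ne (hε.trans_le h).ne').mul hΦs.contDiffAt).neg
  refine ⟨q, hqs, fun x hx => ?_⟩
  have e1 : HasDerivAt (fun y => y ^ α * q y) (α * x ^ (α - 1) * q x + x ^ α * deriv q x) x :=
    (Real.hasDerivAt_rpow_const (Or.inl hx.ne')).mul
      (hqs.differentiable (by simp)).differentiableAt.hasDerivAt
  have e2 : HasDerivAt (fun y => y ^ α * q y) (-φ x) x := by
    refine (hd x).neg.congr_of_eventuallyEq ?_
    filter_upwards [Ioi_mem_nhds hx] with y hy
    have : y ^ α * y ^ (-α) = 1 := by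
      rw [← Real.rpow_add hy, add_neg_cancel, Real.rpow_zero]
    simp only [hq, Pi.neg_apply]
    linear_combination (-Φ y) * this
  exact e1.unique e2

/-- The range of the degenerate operator on `H²` functions vanishing at `1` contains all
compactly supported smooth functions. -/
lemma exists_degenerateOp_ae_eq {α : ℝ} (hα : 1 ≤ α) {φ : ℝ → ℝ} (h1 : ContDiff ℝ ∞ φ)
    (h3 : tsupport φ ⊆ Ioo 0 1) :
    ∃ p : H2, contRep (toL2 p) 1 = 0 ∧
      degenerateOp α hα p =ᵐ[volume.restrict (Ioo (0 : ℝ) 1)] fun x => -φ x := by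
  obtain ⟨q, hq, hqφ⟩ := exists_smooth_flux α h1 h3
  have hqc := hq.continuous
  have hq'c : Continuous (deriv q) := hq.continuous_deriv (by simp)
  -- Basing the primitive at 1 enforces the Dirichlet condition.
  set P : ℝ → ℝ := fun x => ∫ s in (1 : ℝ)..x, q s with hP
  have hPd (x : ℝ) : HasDerivAt P (q x) x :=
    intervalIntegral.integral_hasDerivAt_right (hqc.intervalIntegrable _ _)
      (hqc.stronglyMeasurableAtFilter _ _) hqc.continuousAt
  have hPc : Continuous P := continuous_iff_continuousAt.2 fun x => (hPd x).continuousAt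
  have hqd (x : ℝ) : HasDerivAt q (deriv q x) x :=
    (hq.differentiable (by simp)).differentiableAt.hasDerivAt
  refine ⟨⟨((memLp_of_continuous hPc).toLp, (memLp_of_continuous hqc).toLp,
    (memLp_of_continuous hq'c).toLp), hasWeakDeriv_toLp hPd hqc hPc,
    hasWeakDeriv_toLp hqd hq'c hqc⟩, ?_, ?_⟩
  · have := contRep_eqOn hPc.continuousOn (memLp_of_continuous hPc).coeFn_toLp
      (right_mem_Icc.2 zero_le_one)
    exact this.trans (by simp [hP])
  · filter_upwards [degenerateOp_ae_eq hα _, (memLp_of_continuous hqc).coeFn_toLp,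
      (memLp_of_continuous hq'c).coeFn_toLp, ae_restrict_mem measurableSet_Ioo] with x e1 e2 e3 hx
    rw [e1, e2, e3, hqφ x hx.1]

lemma isTestFunction_const {α : ℝ} (hα : 1 ≤ α) (τ : ℝ) {p : H2}
    (hp : contRep (toL2 p) 1 = 0) : IsTestFunction α τ fun _ => p where
  contDiffOn := contDiffOn_const
  continuousOn := continuousOn_const
  flux_zero _ _ := tendsto_flux hα p
  eq_zero _ _ := hp

lemma IsWeakSolution.integral_identity_const {α T : ℝ} (hα : 1 ≤ α) {f₀ : L2} {u : ℝ → ℝ}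
    {f : ℝ → L2} (hf : IsWeakSolution α T f₀ u f) {τ : ℝ} (hτ : τ ∈ Icc 0 T) {p : H2}
    (hp : contRep (toL2 p) 1 = 0) :
    ∫ t in (0 : ℝ)..τ, inner ℝ (f t) (degenerateOp α hα p)
      = inner ℝ (f τ) (toL2 p) - inner ℝ f₀ (toL2 p)
        + ∫ t in (0 : ℝ)..τ, u t * contRep (dx p) 1 := by
  have h := hf.integral_identity τ hτ _ (isTestFunction_const hα τ hp)
  rw [L2.inner_eq, L2.inner_eq, ← h]
  refine intervalIntegral.integral_congr fun t _ => ?_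
  rw [integral_mul_add_weakDeriv hα]
  simp

/-- Subtracting the identities cancels f₀ and u. Since D reaches every test function φ, what remains
is K h(τ) = -∫₀^τ h for h = f - g. -/
lemma IsWeakSolution.eqOn {α T : ℝ} (hα : 1 ≤ α) (hα' : α < 2) (hT : 0 ≤ T) {f₀ : L2}
    {u : ℝ → ℝ} {f g : ℝ → L2} (hf : IsWeakSolution α T f₀ u f)
    (hg : IsWeakSolution α T f₀ u g) : EqOn f g (Icc 0 T) := by
  intro t ht
  have hc : ContinuousOn (fun t => f t - g t) (Icc 0 T) := hf.continuousOn.sub hg.continuousOn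
  refine sub_eq_zero.1 (eq_zero_of_apply_eq_neg_integral (f := fun t => f t - g t)
    (inner_green_symm hα') (inner_green_nonneg hα') (eq_zero_of_inner_green_eq_zero hα') hT hc
    (fun τ hτ => ?_) ht)
  have hsub : uIcc 0 τ ⊆ Icc 0 T := by
    rw [uIcc_of_le hτ.1]
    exact Icc_subset_Icc_right hτ.2
  have hii : IntervalIntegrable (fun t => f t - g t) volume 0 τ :=
    (hc.mono hsub).intervalIntegrable
  rw [eq_neg_iff_add_eq_zero, Lp.eq_zero_iff_ae_eq_zero]
  refine ae_eq_zero_of_integral_mul_test_eq_zero (L2.locallyIntegrableOn _) fun φ h1 _ h3 => ?_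
  obtain ⟨p, hp, hpφ⟩ := exists_degenerateOp_ae_eq hα h1 h3
  set D := degenerateOp α hα p with hD
  set w := green α hα' (f τ - g τ) + ∫ s in (0 : ℝ)..τ, (f s - g s) with hw
  have e0 : ∫ x in Ioo (0 : ℝ) 1, w x * φ x = -inner ℝ w D := by
    rw [L2.inner_eq, ← integral_neg]
    refine integral_congr_ae ?_
    filter_upwards [hpφ] with x hx
    rw [hx]
    ring
  have e1 := hf.integral_identity_const hα hτ hp
  have e2 := hg.integral_identity_const hα hτ hp
  have i1 : IntervalIntegrable (fun t => inner ℝ (f t) D) volume 0 τ :=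
    ((hf.continuousOn.mono hsub).inner continuousOn_const).intervalIntegrable
  have i2 : IntervalIntegrable (fun t => inner ℝ (g t) D) volume 0 τ :=
    ((hg.continuousOn.mono hsub).inner continuousOn_const).intervalIntegrable
  have e3 : inner ℝ (∫ s in (0 : ℝ)..τ, (f s - g s)) D
      = (∫ t in (0 : ℝ)..τ, inner ℝ (f t) D) - ∫ t in (0 : ℝ)..τ, inner ℝ (g t) D := by
    rw [← intervalIntegral.integral_sub i1 i2, real_inner_comm]
    rw [← innerSL_apply_apply ℝ, ← (innerSL ℝ D).intervalIntegral_comp_comm hii]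
    refine intervalIntegral.integral_congr fun s _ => ?_
    simp only [innerSL_apply_apply, inner_sub_right]
    rw [real_inner_comm, real_inner_comm (g s)]
  -- Symmetry moves K onto D, and K D = -p.
  have e4 : inner ℝ (green α hα' (f τ - g τ)) D
      = -(inner ℝ (f τ) (toL2 p) - inner ℝ (g τ) (toL2 p)) := by
    rw [inner_green_symm, ← green_neg_degenerateOp hα hα' hp, ← inner_sub_left, map_neg,
      inner_neg_right, neg_neg]
  rw [e0, hw, inner_add_left, e3, e4]
  linarith

lemma exists_isWeakSolution {α T : ℝ} (hα : 1 ≤ α) (hα' : α < 2) (hT : 0 < T) (f₀ : L2)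
    {u : ℝ → ℝ} (hu : MemH1 0 T u) : ∃ f : ℝ → L2, IsWeakSolution α T f₀ u f := by
  obtain ⟨-, g, hg, hug⟩ := hu
  have hgi : IntegrableOn g (Ioo 0 T) := hg.integrable (by norm_num)
  obtain ⟨c, hc⟩ := hug.exists_ae_eq_primitive hT hgi
  -- Extending u' by zero gives a globally integrable density, as the Duhamel integral requires.
  set v : ℝ → ℝ := (Ioo 0 T).indicator g with hv
  have hvi : Integrable v := hgi.integrable_indicator measurableSet_Ioo
  obtain ⟨f, hfc, hf0, hf⟩ := exists_forced_solution (inner_green_symm hα')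
    (inner_green_nonneg hα') (green_injective hα') hT.le f₀ one c hvi
    (fun s hs => indicator_of_notMem hs g)
  set U : ℝ → ℝ := fun s => c + ∫ r in (0 : ℝ)..s, v r with hU
  have hUc : Continuous U := continuous_const.add (intervalIntegral.continuous_primitive
    (fun a b => hvi.intervalIntegrable) 0)
  have huU : ∀ᵐ t, t ∈ Ioo 0 T → u t = U t := by
    filter_upwards [(ae_restrict_iff' measurableSet_Ioo).1 hc] with t h1 ht
    rw [h1 ht, hU]
    simp only
    congr 1
    rw [intervalIntegral.integral_of_le ht.1.le, intervalIntegral.integral_of_le ht.1.le]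
    refine setIntegral_congr_fun measurableSet_Ioc fun s hs => ?_
    exact (indicator_of_mem (show s ∈ Ioo 0 T from ⟨hs.1, hs.2.trans_lt ht.2⟩) g).symm
  refine ⟨f, hfc.continuousOn, fun τ hτ ψ hψ => ?_⟩
  have hDc : ContinuousOn (fun t => degenerateOp α hα (ψ t)) (Icc 0 τ) :=
    (continuous_degenerateOp α hα).comp_continuousOn hψ.continuousOn
  have hue : ∫ t in (0 : ℝ)..τ, u t * contRep (dx (ψ t)) 1
      = ∫ t in (0 : ℝ)..τ, U t * inner ℝ one (degenerateOp α hα (ψ t)) := by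
    refine intervalIntegral.integral_congr_ae ?_
    filter_upwards [huU, compl_mem_ae_iff.2 (measure_singleton T)] with t h1 h2 ht
    rw [uIoc_of_le hτ.1] at ht
    rw [h1 ⟨ht.1, lt_of_le_of_ne (ht.2.trans hτ.2) h2⟩, contRep_dx_one hα]
  simp only [integral_mul_add_weakDeriv hα]
  rw [hue, ← L2.inner_eq, ← L2.inner_eq]
  -- For τ = 0 the interval is a point, where derivatives within it are not unique; the identity
  -- then reduces to f 0 = f₀.
  rcases hτ.1.eq_or_lt with h0 | hτ0
  · simp [← h0, hf0]
  set ψ' : ℝ → L2 := fun t => derivWithin (fun s => toL2 (ψ s)) (Icc 0 τ) t with hψ'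
  have hψ'c : ContinuousOn ψ' (Icc 0 τ) :=
    hψ.contDiffOn.continuousOn_derivWithin (uniqueDiffOn_Icc hτ0) le_rfl
  -- Product rule with ψ = K(-Dψ): the term ⟨f - U·1, -Dψ⟩ supplies both ⟨f, Dψ⟩ and the control
  -- term.
  have key := integral_inner_eq_of_mild (inner_green_symm hα') hτ.1 (f := f)
    (y := fun s => f s - U s • one) (ψ := fun s => toL2 (ψ s)) (ψ' := ψ')
    (g := fun s => -degenerateOp α hα (ψ s)) (k := green α hα' f₀) (by fun_prop)
    hfc.continuousOn (fun t ht => hf t ⟨ht.1, ht.2.trans hτ.2⟩)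
    (fun t ht => (green_neg_degenerateOp hα hα' (hψ.eq_zero t ht)).symm)
    hψ.contDiffOn.continuousOn (fun t ht => by
      have hd := (hψ.contDiffOn.differentiableOn one_ne_zero) t (Ioo_subset_Icc_self ht)
      exact hd.hasDerivWithinAt.hasDerivAt (Icc_mem_nhds ht.1 ht.2))
    hψ'c hDc.neg
  rw [hf0] at key
  rw [← key, ← intervalIntegral.integral_add]
  · refine intervalIntegral.integral_congr fun t _ => ?_
    simp only [inner_neg_right, inner_sub_left, inner_smul_left, inner_add_right, hψ',
      RCLike.conj_to_real]
    ring
  · refine ContinuousOn.intervalIntegrable ?_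
    rw [uIcc_of_le hτ.1]
    exact (hfc.continuousOn.inner hψ'c).sub
      ((hfc.sub (hUc.smul continuous_const)).continuousOn.inner hDc.neg)
  · refine ContinuousOn.intervalIntegrable ?_
    rw [uIcc_of_le hτ.1]
    exact hUc.continuousOn.mul (continuousOn_const.inner hDc)

end WellPosedness

end DegenerateParabolic

end

theorem mainTheorem5 (α : ℝ) (hα : α ∈ Set.Ico (1 : ℝ) 2) (T : ℝ) (hT : 0 < T)
    (f₀ : DegenerateParabolic.L2) (u : ℝ → ℝ) (hu : DegenerateParabolic.MemH1 0 T u) :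
    (∃ f : ℝ → DegenerateParabolic.L2, DegenerateParabolic.IsWeakSolution α T f₀ u f) ∧
      ∀ f g : ℝ → DegenerateParabolic.L2,
        DegenerateParabolic.IsWeakSolution α T f₀ u f →
        DegenerateParabolic.IsWeakSolution α T f₀ u g → Set.EqOn f g (Set.Icc 0 T) :=
  ⟨DegenerateParabolic.exists_isWeakSolution hα.1 hα.2 hT f₀ hu,
    fun _ _ hf hg => hf.eqOn hα.1 hα.2 hT.le hg⟩
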